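/- **Regret of the value-incentivized actor-critic method (VAC) under general function approximation.** *Setting.* Let $\mathcal M=(\mathcal S,\mathcal A,P,r,H)$ be an episodic MDP with a measurable state space $\mathcal S$, a finite action set $\mathcal A$ with $|\mathcal A|\ge 2$, horizon $H\ge 1$, transition kernels $P_h(\cdot\mid s,a)$, measurable rewards $r_h:\mathcal S\times\mathcal A\to[0,1]$ ($h\in[H]$) and initial state distribution $\rho$. For a (measurable) policy $\pi=\{\pi_h\}_{h\in[H]}$ let $V^\pi_h(s)$ be the expected reward collected in steps $h,\dots,H$ from $s_h=s$, $Q^\pi_h(s,a)$ the same with $a_h=a$, and $V^\pi(\rho)=\mathbb E_{s\sim\rho}[V_1^\pi(s)]$; let $d^\pi_{\rho,h}$ be the law of $(s_h,a_h)$ under $\pi$ and $s_1\sim\rho$. Let $V^\star_h=\sup_\pi V^\pi_h$, $Q^\star_h=\sup_\pi Q^\pi_h$ and $V^\star(\rho)=\mathbb E_{s\sim\rho}[V^\star_1(s)]$. For $f=\{f_h\}_{h\in[H]}$, $f_h:\mathcal S\times\mathcal A\to\mathbb R$, with $f_{H+1}=0$, put $V_f^\pi(\rho)=\mathbb E_{s\sim\rho,a\sim\pi_1(\cdot|s)}[f_1(s,a)]$,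 $$(\mathbb P^\pi_h f)(s,a)=r_h(s,a)+\mathbb E_{s'\sim P_h(\cdot|s,a),\,a'\sim\pi_{h+1}(\cdot|s')}[f_{h+1}(s',a')],$$ $$\ell_h(f,s,a,\pi)=\big(\mathbb E_{s'\sim P_h(\cdot|s,a),\,a'\sim\pi_{h+1}(\cdot|s')}[r_h(s,a)+f_{h+1}(s',a')-f_h(s,a)]\big)^2 .$$ *Assumptions.* Let $T\ge 1$, $B=\frac{T\log|\mathcal A|}{H}$, let $\mathcal Q=\prod_{h=1}^H\mathcal Q_h$ be a class of measurable functions and $\mathcal P=\prod_{h=1}^H\mathcal P_h$ with $\mathcal P_h=\{\pi_h:\pi_h(a|s)=e^{Bq(s,a)}/\sum_{a'}e^{Bq(s,a')},\ q\in\mathcal Q_h\}$. Assume: 1. $Q^\star\in\mathcal Q$; $\mathbb P^\pi f\in\mathcal Q$ for all $\pi\in\mathcal P$, $f\in\mathcal Q$; and $\|q\|_\infty\le H+1-h$ for all $q\in\mathcal Q_h$, $h\in[H]$. 2. For every $\lambda>0$ there is $d\ge 0$ such that for all $f_1,\dots,f_T\in\mathcal Q$ and $\pi_1,\dots,\pi_T\in\mathcal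 P$ $$\sum_{t=1}^T\big(V^{\pi_t}_{f_t}(\rho)-V^{\pi_t}(\rho)\big)\le\inf_{\eta>0}\Big\{\eta\sum_{t=1}^T\sum_{i=1}^{t-1}\sum_{h=1}^H\mathbb E_{(s,a)\sim d^{\pi_i}_{\rho,h}}\big[\ell_h(f_t,s,a,\pi_t)\big]+\frac{d}{\eta}\Big\}+\sqrt{dHT}+\lambda HT .$$ The smallest such $d$ is denoted $d_{\mathsf{GEC}}(\lambda)$. 3. $\mathcal N(\epsilon')=\max_{h\in[H]}\mathcal N(\mathcal Q_h,\epsilon',\|\cdot\|_\infty)<\infty$ for every $\epsilon'>0$, where $\mathcal N(\mathcal Q_h,\epsilon',\|\cdot\|_\infty)$ is the smallest size of a set of centres in $\mathcal Q_h$ whose $\epsilon'$-balls in the sup norm cover $\mathcal Q_h$. *Algorithm.* VAC with parameter $\alpha>0$ chooses in each episode $t=1,\dots,T$ a maximizer $(f_t,\pi_t)$ of $V_f^\pi(\rho)-\alpha\mathcal L_t(f,\pi)$ over $\mathcal Q\times\mathcal P$ (assumed to exist; ties are broken arbitrarily, possibly at random), and then, conditionally on the past, runs $\pi_t$ from $s_{t,1}\sim\rho$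 to observe $(s_{t,1},a_{t,1},\dots,s_{t,H+1})$. Here $$\mathcal L_t(f,\pi)=\sum_{h=1}^H\Big\{\sum_{i=1}^{t-1}\mathbb E_{a'\sim\pi_{h+1}(\cdot|s_{i,h+1})}\big(r_h(s_{i,h},a_{i,h})+f_{h+1}(s_{i,h+1},a')-f_h(s_{i,h},a_{i,h})\big)^2-\inf_{g\in\mathcal Q_h}\sum_{i=1}^{t-1}\mathbb E_{a'\sim\pi_{h+1}(\cdot|s_{i,h+1})}\big(r_h(s_{i,h},a_{i,h})+f_{h+1}(s_{i,h+1},a')-g(s_{i,h},a_{i,h})\big)^2\Big\}.$$ Its regret is $\mathsf{Regret}(T)=\sum_{t=1}^T\big(V^\star(\rho)-V^{\pi_t}(\rho)\big)$. *Theorem.* There is an absolute constant $C>0$ such that the following holds in every such setting. Let $0<\epsilon\le 1/T$, $\delta\in(0,1)$ and $$L=\log\Big(\frac{HT}{\delta}\Big)+\log\mathcal N\Big(\frac{H\epsilon}{T\log|\mathcal A|}\Big)=\log\Big(\frac{\mathcal N(\epsilon/B)\,HT}{\delta}\Big),\qquad D=\max\Big\{d_{\mathsf{GEC}}\Big(\sqrt{\tfrac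 HT}\Big),\ \frac1L\Big\},$$ and run VAC with $\alpha=\Big(\frac{1}{TH^3L}\,D\Big)^{1/2}$. Then, with probability at least $1-\delta$, $$\mathsf{Regret}(T)\le C\,H^{3/2}\sqrt T\,\sqrt{L\,D}.$$ In particular, whenever $L\,d_{\mathsf{GEC}}(\sqrt{H/T})\ge 1$, one has $D=d_{\mathsf{GEC}}(\sqrt{H/T})$ and $\mathsf{Regret}(T)\le C\,H^{3/2}\sqrt T\sqrt{\big(\log\frac{HT}{\delta}+\log\mathcal N(\frac{H\epsilon}{T\log|\mathcal A|})\big)\,d_{\mathsf{GEC}}(\sqrt{H/T})}$. -/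

import Mathlib

open MeasureTheory ProbabilityTheory

namespace VAC

noncomputable section

/-- An episodic Markov decision process with horizon `H`, time-inhomogeneous transition kernels,
rewards in `[0,1]` and an initial state distribution `ρ`. The steps are numbered `0, …, H - 1`;
`P h` and `r h` with `h ≥ H` are never used. -/
structure EpisodicMDP (S A : Type*) [MeasurableSpace S] [MeasurableSpace A] where
  H : ℕ
  H_pos : 0 < H
  P : ℕ → Kernel (S × A) S
  isMarkov : ∀ h, IsMarkovKernel (P h)
  r : ℕ → S → A → ℝ
  measurable_r : ∀ h a, Measurable fun s => r h s a
  r_mem : ∀ h s a, r h s a ∈ Set.Icc (0 : ℝ) 1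
  ρ : Measure S
  isProb : IsProbabilityMeasure ρ

/-- A policy profile: `π h s a` is the probability of choosing `a` in state `s` at step `h`. -/
structure IsPolicy {S A : Type*} [MeasurableSpace S] [Fintype A] (π : ℕ → S → A → ℝ) : Prop where
  mem_simplex : ∀ h s, π h s ∈ stdSimplex ℝ A
  measurable : ∀ h a, Measurable fun s => π h s a

/-- The softmax policy of the function `q` at inverse temperature `B`. -/
def softmax {S A : Type*} [Fintype A] (B : ℝ) (q : S → A → ℝ) (s : S) (a : A) : ℝ :=
  Real.exp (B * q s a) / ∑ a', Real.exp (B * q s a')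

namespace EpisodicMDP

variable {S A : Type*} [MeasurableSpace S] [MeasurableSpace A] [Fintype A]
variable (M : EpisodicMDP S A)

/-- The joint law of `(a, s')` with `a ∼ π_h(· | s)` and `s' ∼ P_h(· | s, a)`. -/
def stepLaw (π : ℕ → S → A → ℝ) (h : ℕ) (s : S) : Measure (A × S) :=
  ∑ a, ENNReal.ofReal (π h s a) • (M.P h (s, a)).map (Prod.mk a)

/-- The law of the states `s_h, …, s_{h+n}` and actions `a_h, …, a_{h+n-1}` when `s_h ∼ ν` and
the policy `π` is followed. -/
def pathLaw (π : ℕ → S → A → ℝ) (h : ℕ) (ν : Measure S) :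
    (n : ℕ) → Measure ((Fin (n + 1) → S) × (Fin n → A))
  | 0 => ν.map fun s => (fun _ => s, Fin.elim0)
  | n + 1 => (pathLaw π h ν n).bind fun τ =>
      (M.stepLaw π (h + n) (τ.1 (Fin.last n))).map fun x =>
        (Fin.snoc (α := fun _ => S) τ.1 x.2, Fin.snoc (α := fun _ => A) τ.2 x.1)

/-- A full episode `(s_0, …, s_H)`, `(a_0, …, a_{H-1})`. -/
abbrev Traj : Type _ := (Fin (M.H + 1) → S) × (Fin M.H → A)

/-- The law of an episode that starts from `ρ` and follows `π`. -/
def trajLaw (π : ℕ → S → A → ℝ) : Measure M.Traj := M.pathLaw π 0 M.ρ M.H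

/-- The state-action visitation distribution: the law of `(s_h, a_h)` when `s_0 ∼ ρ` and `π` is
followed. -/
def occ (π : ℕ → S → A → ℝ) (h : ℕ) : Measure (S × A) :=
  (M.pathLaw π 0 M.ρ (h + 1)).map fun τ => (τ.1 (Fin.last h).castSucc, τ.2 (Fin.last h))

/-- The value `V^π_h(s)`: the expected reward collected in the steps `h, …, H - 1` from
`s_h = s` on. -/
def V (π : ℕ → S → A → ℝ) (h : ℕ) (s : S) : ℝ :=
  ∫ τ, ∑ i : Fin (M.H - h), M.r (h + i) (τ.1 i.castSucc) (τ.2 i)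
    ∂(M.pathLaw π h (Measure.dirac s) (M.H - h))

/-- The action value `Q^π_h(s, a)`: take `a` in `s` at step `h` and follow `π` thereafter. -/
def Qval (π : ℕ → S → A → ℝ) (h : ℕ) (s : S) (a : A) : ℝ :=
  M.r h s a + ∫ s', M.V π (h + 1) s' ∂(M.P h (s, a))

/-- `V^π(ρ)`. -/
def Vρ (π : ℕ → S → A → ℝ) : ℝ := ∫ s, M.V π 0 s ∂M.ρ

/-- The optimal value function `V^⋆_h`. -/
def Vstar (h : ℕ) (s : S) : ℝ := ⨆ π : {π : ℕ → S → A → ℝ // IsPolicy π}, M.V π.1 h s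

/-- The optimal action value function `Q^⋆_h`. -/
def Qstar (h : ℕ) (s : S) (a : A) : ℝ :=
  ⨆ π : {π : ℕ → S → A → ℝ // IsPolicy π}, M.Qval π.1 h s a

/-- `V^⋆(ρ)`. -/
def Vstarρ : ℝ := ∫ s, M.Vstar 0 s ∂M.ρ

/-- The regret of the policies `π 0, …, π (T - 1)`. -/
def regret (T : ℕ) (π : ℕ → ℕ → S → A → ℝ) : ℝ :=
  ∑ t ∈ Finset.range T, (M.Vstarρ - M.Vρ (π t))

/-- `V_f^π(ρ)`, the value at `ρ` predicted by the critic `f` for the policy `π`. -/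
def Vf (f π : ℕ → S → A → ℝ) : ℝ := ∫ s, ∑ a, π 0 s a * f 0 s a ∂M.ρ

/-- The Bellman operator `(ℙ_h^π f)(s, a)`. -/
def bellman (π f : ℕ → S → A → ℝ) (h : ℕ) (s : S) (a : A) : ℝ :=
  M.r h s a + ∫ s', ∑ a', π (h + 1) s' a' * f (h + 1) s' a' ∂(M.P h (s, a))

/-- The squared Bellman error `ℓ_h(f, s, a, π)`. -/
def ell (f : ℕ → S → A → ℝ) (h : ℕ) (s : S) (a : A) (π : ℕ → S → A → ℝ) : ℝ :=
  (∫ s', ∑ a', π (h + 1) s' a' * (M.r h s a + f (h + 1) s' a' - f h s a) ∂(M.P h (s, a))) ^ 2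

/-- The product class `𝒬 = ∏_h 𝒬_h`, with the convention `f_H = 0` after the last step. -/
def QClass (Q : ℕ → Set (S → A → ℝ)) : Set (ℕ → S → A → ℝ) :=
  {f | (∀ h < M.H, f h ∈ Q h) ∧ ∀ h ≥ M.H, f h = 0}

/-- The class `𝒫 = ∏_h 𝒫_h` of softmax policies built from `𝒬`. What the policy does at the
steps `h ≥ H`, after the end of the episode, has no influence. -/
def PClass (Q : ℕ → Set (S → A → ℝ)) (B : ℝ) : Set (ℕ → S → A → ℝ) :=
  {π | IsPolicy π ∧ ∀ h < M.H, ∃ q ∈ Q h, π h = softmax B q}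

/-- The assumption on the function class: realizability, Bellman completeness, boundedness
(with the steps numbered from `0`), and measurability of its members. -/
structure QClassAssumption (Q : ℕ → Set (S → A → ℝ)) (B : ℝ) : Prop where
  measurable : ∀ h < M.H, ∀ q ∈ Q h, ∀ a, Measurable fun s => q s a
  realizable : ∀ h < M.H, M.Qstar h ∈ Q h
  complete : ∀ π ∈ M.PClass Q B, ∀ f ∈ M.QClass Q, ∀ h < M.H, M.bellman π f h ∈ Q h
  bounded : ∀ h < M.H, ∀ q ∈ Q h, ∀ s a, |q s a| ≤ (M.H : ℝ) - h

/-- `d` is an admissible generalized Eluder coefficient at level `lam`. Being at most the infimum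
over `η > 0` of the right-hand side is written as being at most its value at every `η > 0`. -/
def IsGEC (Q : ℕ → Set (S → A → ℝ)) (B : ℝ) (T : ℕ) (lam d : ℝ) : Prop :=
  0 ≤ d ∧ ∀ f π : ℕ → ℕ → S → A → ℝ,
    (∀ t < T, f t ∈ M.QClass Q) → (∀ t < T, π t ∈ M.PClass Q B) → ∀ η > 0,
      ∑ t ∈ Finset.range T, (M.Vf (f t) (π t) - M.Vρ (π t)) ≤
        η * ∑ t ∈ Finset.range T, ∑ i ∈ Finset.range t, ∑ h ∈ Finset.range M.H,
            ∫ x, M.ell (f t) h x.1 x.2 (π t) ∂(M.occ (π i) h)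
          + d / η + √(d * M.H * T) + lam * M.H * T

/-- The generalized Eluder coefficient `d_GEC(lam)`: the smallest admissible `d`. -/
def dGEC (Q : ℕ → Set (S → A → ℝ)) (B : ℝ) (T : ℕ) (lam : ℝ) : ℝ :=
  sInf {d | M.IsGEC Q B T lam d}

end EpisodicMDP

/-- The `ε`-covering number of a set `F` of functions in the sup norm (centres in `F`). -/
def coveringNumber {S A : Type*} (F : Set (S → A → ℝ)) (ε : ℝ) : ℕ∞ :=
  ⨅ (C : Set (S → A → ℝ)) (_ : C ⊆ F) (_ : ∀ q ∈ F, ∃ c ∈ C, ∀ s a, |q s a - c s a| ≤ ε), C.encard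

namespace EpisodicMDP

variable {S A : Type*} [MeasurableSpace S] [MeasurableSpace A] [Fintype A]
variable (M : EpisodicMDP S A)

/-- `𝒩(ε) = max_h 𝒩(𝒬_h, ε, ‖·‖_∞)`. -/
def maxCovering (Q : ℕ → Set (S → A → ℝ)) (ε : ℝ) : ℕ∞ :=
  ⨆ h : Fin M.H, coveringNumber (Q h) ε

/-- The sum, over the first `t` episodes `τ 0, …, τ (t - 1)`, of
`𝔼_{a' ∼ π_{h+1}(· | s_{h+1})} (r_h(s_h, a_h) + f_{h+1}(s_{h+1}, a') - g(s_h, a_h))²`. -/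
def sqLoss (τ : ℕ → M.Traj) (t : ℕ) (f π : ℕ → S → A → ℝ) (h : Fin M.H) (g : S → A → ℝ) : ℝ :=
  ∑ i ∈ Finset.range t, ∑ a', π (h + 1) ((τ i).1 h.succ) a' *
    (M.r h ((τ i).1 h.castSucc) ((τ i).2 h) + f (h + 1) ((τ i).1 h.succ) a'
      - g ((τ i).1 h.castSucc) ((τ i).2 h)) ^ 2

/-- The loss `ℒ(f, π)` computed from the data of the first `t` episodes. -/
def loss (Q : ℕ → Set (S → A → ℝ)) (τ : ℕ → M.Traj) (t : ℕ) (f π : ℕ → S → A → ℝ) : ℝ :=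
  ∑ h : Fin M.H, (M.sqLoss τ t f π h (f h) - ⨅ g : Q h, M.sqLoss τ t f π h g.1)

/-- `(f t, π t, τ t)` for `t < T` is a run of the value-incentivized actor-critic method with
regularization coefficient `α`. In episode `t` (numbered from `0`), `(f t, π t)` maximizes
`V_f^π(ρ) - α ℒ(f, π)` over `𝒬 × 𝒫` for the data of the previous episodes, and then, conditionally
on the past `ℱ t`, the trajectory `τ t` has the law of an episode under the policy `π t`. The
filtration may be larger than the one generated by the data, so that ties between maximizers may
be broken in any way, also at random. -/
structure IsVACRun (Q : ℕ → Set (S → A → ℝ)) (B α : ℝ) (T : ℕ)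
    {Ω : Type*} {mΩ : MeasurableSpace Ω} (μ : Measure Ω) (ℱ : Filtration ℕ mΩ)
    (f π : ℕ → Ω → ℕ → S → A → ℝ) (τ : ℕ → Ω → M.Traj) : Prop where
  f_mem : ∀ t < T, ∀ ω, f t ω ∈ M.QClass Q
  π_mem : ∀ t < T, ∀ ω, π t ω ∈ M.PClass Q B
  maximal : ∀ t < T, ∀ ω, ∀ f' ∈ M.QClass Q, ∀ π' ∈ M.PClass Q B,
    M.Vf f' π' - α * M.loss Q (fun i => τ i ω) t f' π' ≤
      M.Vf (f t ω) (π t ω) - α * M.loss Q (fun i => τ i ω) t (f t ω) (π t ω)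
  adapted : ∀ t < T, Measurable[ℱ (t + 1)] (τ t)
  law : ∀ t < T, ∀ E : Set M.Traj, MeasurableSet E →
    μ[(τ t ⁻¹' E).indicator (fun _ => (1 : ℝ)) | ℱ t] =ᵐ[μ]
      fun ω => (M.trajLaw (π t ω)).real E

end EpisodicMDP

end

end VAC

/-! The argument is optimism plus least-squares concentration. Let `π'` be the softmax policy of
`Qstar` and `f'` its own action value. Both lie in the classes: completeness, iterated from `Qstar`,
produces `f'`. The pair has zero Bellman error, and `π'` is optimal up to `log |A| / B` per step
(`exists_comparator`), hence up to `H²` in total over `T` episodes, by the choice of `B`.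

The difference between the squared loss of `g` and that of the true backup is a sum of terms whose
conditional means are the squared errors of `g` and whose conditional second moments are at most a
constant times `H²` times those means. Bernstein's inequality (`measure_excess_deviation`) and a
union bound over nets (`exists_uniform_deviation`) therefore give, simultaneously for all `f`, `π`,
`g`, a lower bound of half the expected squared errors minus `β`, with `β` of order `H² L`.
Consequently the loss of the comparator is at most `Hβ` (`loss_le_of_bellman_eq`), while the loss of
any pair is at least half its accumulated squared Bellman error minus `Hβ` (`le_loss`).

Maximality of `(f t, π t)` against the comparator then bounds the regret by the overestimation `Vf -
Vρ` minus `α/2` times the accumulated Bellman errors, plus `2αHβ` per episode. The Eluder inequality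
at `η = α/2` cancels those errors exactly and leaves `2d/α` and lower-order terms
(`regret_le_of_loss_bounds`). The prescribed `α` makes `α T H³ L` and `D/α` both equal to the
claimed rate. -/

namespace VAC

/-! ### Bounded measurable functions and averages over probability vectors. -/

/-- Bounded measurable real functions. -/
structure BddMeas {X : Type*} [MeasurableSpace X] (F : X → ℝ) : Prop where
  meas : Measurable F
  bdd : ∃ C, ∀ x, |F x| ≤ C

namespace BddMeas

variable {X Y : Type*} [MeasurableSpace X] [MeasurableSpace Y] {F G : X → ℝ}

theorem integrable (hF : BddMeas F) (μ : Measure X) [IsFiniteMeasure μ] : Integrable F μ := by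
  obtain ⟨C, hC⟩ := hF.bdd
  exact Integrable.of_bound hF.meas.aestronglyMeasurable C (Filter.Eventually.of_forall hC)

theorem const (c : ℝ) : BddMeas fun _ : X => c :=
  ⟨measurable_const, |c|, fun _ => le_rfl⟩

theorem comp (hF : BddMeas F) {φ : Y → X} (hφ : Measurable φ) : BddMeas fun y => F (φ y) :=
  ⟨hF.meas.comp hφ, hF.bdd.imp fun _ h _ => h _⟩

theorem add (hF : BddMeas F) (hG : BddMeas G) : BddMeas fun x => F x + G x := by
  obtain ⟨C, hC⟩ := hF.bdd
  obtain ⟨D, hD⟩ := hG.bdd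
  exact ⟨hF.meas.add hG.meas, C + D, fun x => (abs_add_le _ _).trans (add_le_add (hC x) (hD x))⟩

theorem mul (hF : BddMeas F) (hG : BddMeas G) : BddMeas fun x => F x * G x := by
  obtain ⟨C, hC⟩ := hF.bdd
  obtain ⟨D, hD⟩ := hG.bdd
  refine ⟨hF.meas.mul hG.meas, C * D, fun x => ?_⟩
  rw [abs_mul]
  exact mul_le_mul (hC x) (hD x) (abs_nonneg _) ((abs_nonneg _).trans (hC x))

theorem sub (hF : BddMeas F) (hG : BddMeas G) : BddMeas fun x => F x - G x := by
  simpa [sub_eq_add_neg] using hF.add ((const (-1)).mul hG)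

theorem pow (hF : BddMeas F) (n : ℕ) : BddMeas fun x => F x ^ n := by
  induction n with
  | zero => simpa using const 1
  | succ n ih => simpa [pow_succ] using ih.mul hF

theorem finset_sum {ι : Type*} (s : Finset ι) {F : ι → X → ℝ} (hF : ∀ i ∈ s, BddMeas (F i)) :
    BddMeas fun x => ∑ i ∈ s, F i x := by
  classical
  induction s using Finset.induction_on with
  | empty => simpa using const 0
  | insert i s hi ih =>
    simp only [Finset.sum_insert hi]
    exact (hF i (Finset.mem_insert_self _ _)).add
      (ih fun j hj => hF j (Finset.mem_insert_of_mem hj))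

theorem exp (hF : BddMeas F) : BddMeas fun x => Real.exp (F x) := by
  obtain ⟨C, hC⟩ := hF.bdd
  refine ⟨hF.meas.exp, Real.exp C, fun x => ?_⟩
  rw [abs_of_pos (Real.exp_pos _)]
  exact Real.exp_le_exp.2 ((le_abs_self _).trans (hC x))

theorem abs_integral_le {C : ℝ} (hC : ∀ x, |F x| ≤ C) (μ : Measure X) [IsProbabilityMeasure μ] :
    |∫ x, F x ∂μ| ≤ C := by
  have := norm_integral_le_of_norm_le_const (μ := μ) (f := F) (C := C)
    (Filter.Eventually.of_forall hC)
  simpa using this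

theorem integral_kernel (hF : BddMeas F) (κ : Kernel Y X) [IsMarkovKernel κ] :
    BddMeas fun y => ∫ x, F x ∂κ y := by
  obtain ⟨C, hC⟩ := hF.bdd
  exact ⟨(hF.meas.stronglyMeasurable.integral_kernel).measurable, C,
    fun y => abs_integral_le hC _⟩

theorem of_mem_simplex {A : Type*} [Fintype A] {p : X → A → ℝ} (hp : ∀ x, p x ∈ stdSimplex ℝ A)
    {a : A} (hm : Measurable fun x => p x a) : BddMeas fun x => p x a := by
  refine ⟨hm, 1, fun x => ?_⟩
  rw [abs_of_nonneg ((hp x).1 a), ← (hp x).2]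
  exact Finset.single_le_sum (fun b _ => (hp x).1 b) (Finset.mem_univ a)

theorem of_fst {A : Type*} [MeasurableSpace A] [MeasurableSingletonClass A] [Fintype A]
    {G : X × A → ℝ} {C : ℝ} (hm : ∀ a, Measurable fun x => G (x, a)) (hC : ∀ x, |G x| ≤ C) :
    BddMeas G :=
  ⟨measurable_from_prod_countable_left hm, C, hC⟩

end BddMeas

theorem abs_simplex_sum_le {A : Type*} [Fintype A] {p : A → ℝ} (hp : p ∈ stdSimplex ℝ A)
    {x : A → ℝ} {C : ℝ} (hx : ∀ a, |x a| ≤ C) : |∑ a, p a * x a| ≤ C := by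
  calc |∑ a, p a * x a| ≤ ∑ a, |p a * x a| := Finset.abs_sum_le_sum_abs _ _
    _ ≤ ∑ a, p a * C := Finset.sum_le_sum fun a _ => by
        rw [abs_mul, abs_of_nonneg (hp.1 a)]
        exact mul_le_mul_of_nonneg_left (hx a) (hp.1 a)
    _ = C := by rw [← Finset.sum_mul, hp.2, one_mul]

theorem simplex_sum_le {A : Type*} [Fintype A] {p : A → ℝ} (hp : p ∈ stdSimplex ℝ A)
    {x : A → ℝ} {C : ℝ} (hx : ∀ a, x a ≤ C) : ∑ a, p a * x a ≤ C := by
  calc ∑ a, p a * x a ≤ ∑ a, p a * C :=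
        Finset.sum_le_sum fun a _ => mul_le_mul_of_nonneg_left (hx a) (hp.1 a)
    _ = C := by rw [← Finset.sum_mul, hp.2, one_mul]

theorem integral_measure_bind {X Y : Type*} [MeasurableSpace X] [MeasurableSpace Y] (μ : Measure X)
    [IsProbabilityMeasure μ] (κ : Kernel X Y) [IsMarkovKernel κ] {F : Y → ℝ} (hF : BddMeas F) :
    ∫ y, F y ∂(μ.bind κ) = ∫ x, ∫ y, F y ∂κ x ∂μ := by
  rw [← Measure.snd_compProd, Measure.snd, integral_map measurable_snd.aemeasurable
    hF.meas.aestronglyMeasurable]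
  exact Measure.integral_compProd ((hF.comp measurable_snd).integrable _)

/-! ### Path laws and visitation distributions. -/

namespace EpisodicMDP

variable {S A : Type*} [MeasurableSpace S] [MeasurableSpace A] [MeasurableSingletonClass A]
  [Fintype A] (M : EpisodicMDP S A)

attribute [instance] EpisodicMDP.isMarkov EpisodicMDP.isProb

section Paths

variable {π : ℕ → S → A → ℝ} (hπ : IsPolicy π)

omit [MeasurableSingletonClass A] in
include hπ in
theorem measurable_stepLaw (h : ℕ) : Measurable (M.stepLaw π h) := by
  refine Measure.measurable_of_measurable_coe _ fun E hE => ?_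
  simp only [stepLaw, Measure.coe_finsetSum, Finset.sum_apply, Measure.smul_apply, smul_eq_mul]
  refine Finset.measurable_sum _ fun a _ => ((hπ.measurable h a).ennreal_ofReal).mul ?_
  simp_rw [Measure.map_apply measurable_prodMk_left hE]
  exact ((M.P h).measurable_coe (measurable_prodMk_left hE)).comp measurable_prodMk_right

omit [MeasurableSingletonClass A] in
include hπ in
theorem isProbabilityMeasure_stepLaw (h : ℕ) (s : S) : IsProbabilityMeasure (M.stepLaw π h s) := by
  constructor
  simp only [stepLaw, Measure.coe_finsetSum, Finset.sum_apply, Measure.smul_apply, smul_eq_mul]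
  simp_rw [Measure.map_apply measurable_prodMk_left MeasurableSet.univ, Set.preimage_univ,
    measure_univ, mul_one]
  rw [← ENNReal.ofReal_sum_of_nonneg fun a _ => (hπ.mem_simplex h s).1 a,
    (hπ.mem_simplex h s).2, ENNReal.ofReal_one]

omit [MeasurableSingletonClass A] in
include hπ in
theorem integral_stepLaw (h : ℕ) (s : S) {F : A × S → ℝ} (hF : BddMeas F) :
    ∫ x, F x ∂(M.stepLaw π h s) = ∑ a, π h s a * ∫ s', F (a, s') ∂(M.P h (s, a)) := by
  have hi : ∀ a, IsProbabilityMeasure ((M.P h (s, a)).map (Prod.mk a : S → A × S)) := fun a =>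
    Measure.isProbabilityMeasure_map measurable_prodMk_left.aemeasurable
  rw [stepLaw, integral_finsetSum_measure fun a _ =>
    (hF.integrable _).smul_measure ENNReal.ofReal_ne_top]
  refine Finset.sum_congr rfl fun a _ => ?_
  rw [integral_smul_measure, integral_map measurable_prodMk_left.aemeasurable
    hF.meas.aestronglyMeasurable, ENNReal.toReal_ofReal ((hπ.mem_simplex h s).1 a), smul_eq_mul]

/-- The kernel of one step of the episode. -/
noncomputable def stepKernel (h : ℕ) : Kernel S (A × S) := ⟨M.stepLaw π h, M.measurable_stepLaw hπ h⟩

instance (h : ℕ) : IsMarkovKernel (M.stepKernel hπ h) :=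
  ⟨M.isProbabilityMeasure_stepLaw hπ h⟩

/-- A path of `n` steps extended by one step. -/
def extendPath {S A : Type*} {n : ℕ} (τ : (Fin (n + 1) → S) × (Fin n → A)) (x : A × S) :
    (Fin (n + 2) → S) × (Fin (n + 1) → A) :=
  (Fin.snoc (α := fun _ => S) τ.1 x.2, Fin.snoc (α := fun _ => A) τ.2 x.1)

theorem measurable_extendPath {S A : Type*} [MeasurableSpace S] [MeasurableSpace A] {n : ℕ} :
    Measurable fun p : ((Fin (n + 1) → S) × (Fin n → A)) × (A × S) => extendPath p.1 p.2 := by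
  refine Measurable.prodMk ?_ ?_
  · refine measurable_pi_lambda _ fun i => ?_
    induction i using Fin.lastCases with
    | last => simp only [Fin.snoc_last]; fun_prop
    | cast i => simp only [Fin.snoc_castSucc]; fun_prop
  · refine measurable_pi_lambda _ fun i => ?_
    induction i using Fin.lastCases with
    | last => simp only [Fin.snoc_last]; fun_prop
    | cast i => simp only [Fin.snoc_castSucc]; fun_prop

theorem measurable_extendPath_right {S A : Type*} [MeasurableSpace S] [MeasurableSpace A] {n : ℕ}
    (τ : (Fin (n + 1) → S) × (Fin n → A)) : Measurable (extendPath τ) :=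
  measurable_extendPath.comp measurable_prodMk_left

/-- The kernel that extends a path by one step. -/
noncomputable def extendKernel (h n : ℕ) :
    Kernel ((Fin (n + 1) → S) × (Fin n → A)) ((Fin (n + 2) → S) × (Fin (n + 1) → A)) where
  toFun τ := (M.stepLaw π (h + n) (τ.1 (Fin.last n))).map (extendPath τ)
  measurable' := by
    refine Measure.measurable_of_measurable_coe _ fun E hE => ?_
    simp_rw [Measure.map_apply (measurable_extendPath_right _) hE]
    have hl : Measurable fun τ : (Fin (n + 1) → S) × (Fin n → A) => τ.1 (Fin.last n) := by fun_prop
    exact Kernel.measurable_kernel_prodMk_left (κ := (M.stepKernel hπ (h + n)).comap _ hl)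
      (measurable_extendPath hE)

instance (h n : ℕ) : IsMarkovKernel (M.extendKernel hπ h n) :=
  ⟨fun τ => by
    have := M.isProbabilityMeasure_stepLaw hπ (h + n) (τ.1 (Fin.last n))
    exact Measure.isProbabilityMeasure_map (measurable_extendPath_right τ).aemeasurable⟩

omit [MeasurableSingletonClass A] in
-- The `bind` in the definition is along a bare function; recognizing a Markov kernel supplies the
-- measurability without which `bind` carries no information.
theorem pathLaw_succ (h : ℕ) (ν : Measure S) (n : ℕ) :
    M.pathLaw π h ν (n + 1) = (M.pathLaw π h ν n).bind (M.extendKernel hπ h n) := rfl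

omit [MeasurableSingletonClass A] in
include hπ in
theorem isProbabilityMeasure_pathLaw (h : ℕ) (ν : Measure S) [IsProbabilityMeasure ν] (n : ℕ) :
    IsProbabilityMeasure (M.pathLaw π h ν n) := by
  induction n with
  | zero =>
    exact Measure.isProbabilityMeasure_map (by fun_prop)
  | succ n ih => rw [M.pathLaw_succ hπ]; infer_instance

omit [MeasurableSingletonClass A] in
include hπ in
theorem integral_pathLaw_succ (h : ℕ) (ν : Measure S) [IsProbabilityMeasure ν] (n : ℕ)
    {F : (Fin (n + 2) → S) × (Fin (n + 1) → A) → ℝ} (hF : BddMeas F) :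
    ∫ τ, F τ ∂(M.pathLaw π h ν (n + 1)) =
      ∫ τ, ∑ a, π (h + n) (τ.1 (Fin.last n)) a *
        ∫ s', F (extendPath τ (a, s')) ∂(M.P (h + n) (τ.1 (Fin.last n), a))
          ∂(M.pathLaw π h ν n) := by
  have := M.isProbabilityMeasure_pathLaw hπ h ν n
  rw [M.pathLaw_succ hπ, integral_measure_bind _ _ hF]
  refine integral_congr_ae (Filter.Eventually.of_forall fun τ => ?_)
  change ∫ y, F y ∂((M.stepLaw π (h + n) (τ.1 (Fin.last n))).map (extendPath τ)) = _
  rw [integral_map (measurable_extendPath_right τ).aemeasurable hF.meas.aestronglyMeasurable]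
  exact M.integral_stepLaw hπ _ _ (hF.comp (measurable_extendPath_right τ))

omit [MeasurableSingletonClass A] in
/-- The expectation of `F (s_k, a_k, s_{k+1})` for the step out of the `k`-th state. -/
theorem integral_pathLaw_step (hπ : IsPolicy π) (h : ℕ) (ν : Measure S) [IsProbabilityMeasure ν]
    (k n : ℕ) (hk : k < n) {F : S × A × S → ℝ} (hF : BddMeas F) :
    ∫ τ, F (τ.1 ⟨k, by omega⟩, τ.2 ⟨k, hk⟩, τ.1 ⟨k + 1, by omega⟩) ∂(M.pathLaw π h ν n) =
      ∫ τ, ∑ a, π (h + k) (τ.1 (Fin.last k)) a *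
        ∫ s', F (τ.1 (Fin.last k), a, s') ∂(M.P (h + k) (τ.1 (Fin.last k), a))
          ∂(M.pathLaw π h ν k) := by
  induction n with
  | zero => omega
  | succ n ih =>
    have hm := (M.isProbabilityMeasure_pathLaw hπ h ν n)
    rw [M.integral_pathLaw_succ hπ h ν n (hF.comp (by fun_prop))]
    -- If the step lies in the shorter path, the added step integrates to one; otherwise it is the
    -- added step itself.
    rcases Nat.lt_succ_iff_lt_or_eq.1 hk with hkn | rfl
    · rw [← ih hkn]
      refine integral_congr_ae (Filter.Eventually.of_forall fun τ => ?_)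
      have e1 : ∀ x : A × S, (extendPath τ x).1 ⟨k, by omega⟩ = τ.1 ⟨k, by omega⟩ := fun x =>
        Fin.snoc_castSucc (α := fun _ => S) x.2 τ.1 ⟨k, by omega⟩
      have e2 : ∀ x : A × S, (extendPath τ x).2 ⟨k, by omega⟩ = τ.2 ⟨k, by omega⟩ := fun x =>
        Fin.snoc_castSucc (α := fun _ => A) x.1 τ.2 ⟨k, by omega⟩
      have e3 : ∀ x : A × S, (extendPath τ x).1 ⟨k + 1, by omega⟩ = τ.1 ⟨k + 1, by omega⟩ := fun x =>
        Fin.snoc_castSucc (α := fun _ => S) x.2 τ.1 ⟨k + 1, by omega⟩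
      simp only [e1, e2, e3, integral_const, probReal_univ, one_smul]
      rw [← Finset.sum_mul, (hπ.mem_simplex _ _).2, one_mul]
    · refine integral_congr_ae (Filter.Eventually.of_forall fun τ => ?_)
      have e1 : ∀ x : A × S, (extendPath τ x).1 ⟨k, by omega⟩ = τ.1 (Fin.last k) := fun x =>
        Fin.snoc_castSucc (α := fun _ => S) x.2 τ.1 (Fin.last k)
      have e2 : ∀ x : A × S, (extendPath τ x).2 ⟨k, by omega⟩ = x.1 := fun x =>
        Fin.snoc_last (α := fun _ => A) x.1 τ.2
      have e3 : ∀ x : A × S, (extendPath τ x).1 ⟨k + 1, by omega⟩ = x.2 := fun x =>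
        Fin.snoc_last (α := fun _ => S) x.2 τ.1
      simp only [e1, e2, e3]

omit [MeasurableSingletonClass A] in
/-- Expectations under the visitation distribution. -/
theorem integral_occ (hπ : IsPolicy π) (h : ℕ) {G : S × A → ℝ} (hG : BddMeas G) :
    ∫ x, G x ∂(M.occ π h) =
      ∫ τ, ∑ a, π h (τ.1 (Fin.last h)) a * G (τ.1 (Fin.last h), a) ∂(M.pathLaw π 0 M.ρ h) := by
  rw [occ, integral_map (by fun_prop) hG.meas.aestronglyMeasurable]
  have := M.integral_pathLaw_step hπ 0 M.ρ h (h + 1) (Nat.lt_succ_self h)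
    (F := fun x => G (x.1, x.2.1)) (hG.comp (by fun_prop))
  simp only [zero_add, integral_const, probReal_univ, one_smul] at this
  exact this

omit [MeasurableSingletonClass A] in
-- Connects the law of the observed data to `occ`, in terms of which the Eluder coefficient is
-- stated: given `(s_h, a_h)`, the next state is a fresh draw from `P h`.
theorem integral_trajLaw_step (hπ : IsPolicy π) (h : Fin M.H) {F : S × A × S → ℝ}
    (hF : BddMeas F) :
    ∫ τ, F (τ.1 h.castSucc, τ.2 h, τ.1 h.succ) ∂(M.trajLaw π) =
      ∫ x, ∫ s', F (x.1, x.2, s') ∂(M.P h x) ∂(M.occ π h) := by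
  have hG : BddMeas fun x : S × A => ∫ s', F (x.1, x.2, s') ∂(M.P h x) := by
    obtain ⟨C, hC⟩ := hF.bdd
    refine ⟨?_, C, fun x => BddMeas.abs_integral_le (fun s' => hC _) _⟩
    have : StronglyMeasurable (Function.uncurry fun (x : S × A) (s' : S) => F (x.1, x.2, s')) :=
      (hF.meas.comp (by fun_prop)).stronglyMeasurable
    exact (StronglyMeasurable.integral_kernel_prod_right (κ := M.P h) this).measurable
  rw [M.integral_occ hπ h hG]
  have := M.integral_pathLaw_step hπ 0 M.ρ h M.H h.2 hF
  simp only [zero_add] at this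
  exact this

end Paths

end EpisodicMDP

end VAC

namespace VAC
namespace EpisodicMDP

variable {S A : Type*} [MeasurableSpace S] [MeasurableSpace A] [MeasurableSingletonClass A]
  [Fintype A] (M : EpisodicMDP S A)

/-! ### Value functions and their Bellman recursion. -/

section Values

variable {π : ℕ → S → A → ℝ}

/-- The operator `F ↦ 𝔼[F(s_{h+1}) | s_h = ·]` of a policy. -/
noncomputable def stepOp (π : ℕ → S → A → ℝ) (h : ℕ) (F : S → ℝ) (s : S) : ℝ :=
  ∑ a, π h s a * ∫ s', F s' ∂(M.P h (s, a))

/-- The expected reward of step `h` in a given state. -/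
noncomputable def rewardOp (π : ℕ → S → A → ℝ) (h : ℕ) (s : S) : ℝ := ∑ a, π h s a * M.r h s a

/-- The operator `F ↦ 𝔼[F(s_{h+n}) | s_h = ·]` of a policy. -/
noncomputable def iterOp (π : ℕ → S → A → ℝ) : ℕ → ℕ → (S → ℝ) → S → ℝ
  | 0, _, F => F
  | n + 1, h, F => M.stepOp π h (iterOp π n (h + 1) F)

omit [MeasurableSingletonClass A] in
-- The value recursion peels off the first step, whereas path laws grow at the last one; this
-- identity passes from one order to the other.
theorem iterOp_succ (n h : ℕ) (F : S → ℝ) :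
    M.iterOp π (n + 1) h F = M.iterOp π n h (M.stepOp π (h + n) F) := by
  induction n generalizing h with
  | zero => rfl
  | succ n ih =>
    rw [iterOp, ih (h + 1), iterOp, Nat.add_right_comm, Nat.add_assoc]

omit [Fintype A] [MeasurableSingletonClass A] in
theorem bddMeas_integral_P (h : ℕ) (a : A) {F : S → ℝ} (hF : BddMeas F) :
    BddMeas fun s => ∫ s', F s' ∂(M.P h (s, a)) :=
  (hF.integral_kernel (M.P h)).comp measurable_prodMk_right

omit [MeasurableSpace A] [MeasurableSingletonClass A] in
theorem bddMeas_policy (hπ : IsPolicy π) (h : ℕ) (a : A) : BddMeas fun s => π h s a :=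
  BddMeas.of_mem_simplex (hπ.mem_simplex h) (hπ.measurable h a)

omit [Fintype A] [MeasurableSingletonClass A] in
theorem abs_reward_le (h : ℕ) (s : S) (a : A) : |M.r h s a| ≤ 1 := by
  rw [abs_of_nonneg (M.r_mem h s a).1]
  exact (M.r_mem h s a).2

omit [Fintype A] [MeasurableSingletonClass A] in
theorem bddMeas_reward (h : ℕ) (a : A) : BddMeas fun s => M.r h s a :=
  ⟨M.measurable_r h a, 1, fun s => M.abs_reward_le h s a⟩

theorem bddMeas_reward_prod (h : ℕ) : BddMeas fun x : S × A => M.r h x.1 x.2 :=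
  BddMeas.of_fst (fun a => M.measurable_r h a) fun x => M.abs_reward_le h x.1 x.2

omit [MeasurableSingletonClass A] in
theorem bddMeas_stepOp (hπ : IsPolicy π) (h : ℕ) {F : S → ℝ} (hF : BddMeas F) :
    BddMeas (M.stepOp π h F) :=
  BddMeas.finset_sum _ fun a _ => (bddMeas_policy hπ h a).mul (M.bddMeas_integral_P h a hF)

omit [MeasurableSingletonClass A] in
theorem bddMeas_iterOp (hπ : IsPolicy π) (n h : ℕ) {F : S → ℝ} (hF : BddMeas F) :
    BddMeas (M.iterOp π n h F) := by
  induction n generalizing h with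
  | zero => exact hF
  | succ n ih => exact M.bddMeas_stepOp hπ h (ih (h + 1))

omit [MeasurableSingletonClass A] in
theorem bddMeas_rewardOp (hπ : IsPolicy π) (h : ℕ) : BddMeas (M.rewardOp π h) :=
  BddMeas.finset_sum _ fun a _ => (bddMeas_policy hπ h a).mul (M.bddMeas_reward h a)

omit [MeasurableSingletonClass A] in
theorem integral_pathLaw_last (hπ : IsPolicy π) (h : ℕ) (ν : Measure S) [IsProbabilityMeasure ν]
    (n : ℕ) {F : S → ℝ} (hF : BddMeas F) :
    ∫ τ, F (τ.1 (Fin.last n)) ∂(M.pathLaw π h ν n) = ∫ s, M.iterOp π n h F s ∂ν := by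
  induction n generalizing F with
  | zero =>
    rw [pathLaw, integral_map (by fun_prop) (hF.comp (by fun_prop)).meas.aestronglyMeasurable]
    rfl
  | succ n ih =>
    rw [iterOp_succ, ← ih (M.bddMeas_stepOp hπ _ hF)]
    exact M.integral_pathLaw_step hπ h ν n (n + 1) (Nat.lt_succ_self n) (F := fun x => F x.2.2)
      (hF.comp (by fun_prop))

/-- Replaces integrals over paths by iterates of one-step operators, from which measurability and
the Bellman recursion can be read off. -/
theorem V_eq_sum (hπ : IsPolicy π) (h : ℕ) (s : S) :
    M.V π h s = ∑ i ∈ Finset.range (M.H - h), M.iterOp π i h (M.rewardOp π (h + i)) s := by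
  have hp := M.isProbabilityMeasure_pathLaw hπ h (Measure.dirac s) (M.H - h)
  rw [V, integral_finsetSum, ← Fin.sum_univ_eq_sum_range
    (fun i => M.iterOp π i h (M.rewardOp π (h + i)) s)]
  · refine Finset.sum_congr rfl fun i _ => ?_
    have h1 := M.integral_pathLaw_step hπ h (Measure.dirac s) i (M.H - h) i.2
      (F := fun x => M.r (h + i) x.1 x.2.1) ((M.bddMeas_reward_prod _).comp
        (φ := fun x : S × A × S => (x.1, x.2.1)) (by fun_prop))
    have h2 := M.integral_pathLaw_last hπ h (Measure.dirac s) i (M.bddMeas_rewardOp hπ (h + i))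
    rw [integral_dirac' _ _
      (M.bddMeas_iterOp hπ i h (M.bddMeas_rewardOp hπ _)).meas.stronglyMeasurable] at h2
    simp only [integral_const, probReal_univ, one_smul] at h1
    rw [← h2]
    exact h1
  · intro i _
    exact ((M.bddMeas_reward_prod _).comp (φ := fun τ : (Fin (M.H - h + 1) → S) × (Fin (M.H - h) → A)
      => (τ.1 i.castSucc, τ.2 i)) (by fun_prop)).integrable _

theorem bddMeas_V (hπ : IsPolicy π) (h : ℕ) : BddMeas (M.V π h) := by
  rw [funext (M.V_eq_sum hπ h)]
  exact BddMeas.finset_sum _ fun i _ => M.bddMeas_iterOp hπ i h (M.bddMeas_rewardOp hπ _)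

theorem V_of_le (hπ : IsPolicy π) {h : ℕ} (hh : M.H ≤ h) (s : S) : M.V π h s = 0 := by
  rw [M.V_eq_sum hπ, Nat.sub_eq_zero_of_le hh, Finset.sum_range_zero]

theorem V_eq_sum_Qval (hπ : IsPolicy π) {h : ℕ} (hh : h < M.H) (s : S) :
    M.V π h s = ∑ a, π h s a * M.Qval π h s a := by
  obtain ⟨k, hk⟩ : ∃ k, M.H - h = k + 1 := ⟨M.H - h - 1, by omega⟩
  have hk' : M.H - (h + 1) = k := by omega
  have hV : ∀ a, ∫ s', M.V π (h + 1) s' ∂(M.P h (s, a)) = ∑ i ∈ Finset.range k,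
      ∫ s', M.iterOp π i (h + 1) (M.rewardOp π (h + 1 + i)) s' ∂(M.P h (s, a)) := by
    intro a
    rw [← integral_finsetSum _ fun i _ =>
      (M.bddMeas_iterOp hπ i (h + 1) (M.bddMeas_rewardOp hπ _)).integrable _]
    simp_rw [M.V_eq_sum hπ (h + 1), hk']
  rw [M.V_eq_sum hπ, hk, Finset.sum_range_succ']
  simp only [Qval, mul_add, Finset.sum_add_distrib, hV, Finset.mul_sum]
  rw [add_comm, Finset.sum_comm]
  refine congrArg₂ _ rfl (Finset.sum_congr rfl fun i _ => ?_)
  rw [iterOp, stepOp, show h + (i + 1) = h + 1 + i by omega]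

theorem V_mem_Icc (hπ : IsPolicy π) {h : ℕ} (hh : h ≤ M.H) (s : S) :
    M.V π h s ∈ Set.Icc (0 : ℝ) (M.H - h) := by
  induction hh using Nat.decreasingInduction generalizing s with
  | self => simp [M.V_of_le hπ le_rfl]
  | of_succ k hk ih =>
    rw [M.V_eq_sum_Qval hπ hk]
    have h0 : ∀ a, 0 ≤ ∫ s', M.V π (k + 1) s' ∂(M.P k (s, a)) := fun a =>
      integral_nonneg fun s' => (ih s').1
    have h1 : ∀ a, ∫ s', M.V π (k + 1) s' ∂(M.P k (s, a)) ≤ M.H - (k + 1) := fun a => by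
      have := integral_mono ((M.bddMeas_V hπ (k + 1)).integrable (M.P k (s, a)))
        (integrable_const ((M.H : ℝ) - ((k + 1 : ℕ) : ℝ))) fun s' => (ih s').2
      simpa using this
    refine ⟨Finset.sum_nonneg fun a _ => mul_nonneg ((hπ.mem_simplex k s).1 a)
      (add_nonneg (M.r_mem k s a).1 (h0 a)), simplex_sum_le (hπ.mem_simplex k s) fun a => ?_⟩
    have := (M.r_mem k s a).2
    have := h1 a
    rw [Qval]
    linarith

theorem Qval_mem_Icc (hπ : IsPolicy π) {h : ℕ} (hh : h < M.H) (s : S) (a : A) :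
    M.Qval π h s a ∈ Set.Icc (0 : ℝ) (M.H - h) := by
  have h1 := integral_mono ((M.bddMeas_V hπ (h + 1)).integrable (M.P h (s, a)))
    (integrable_const ((M.H : ℝ) - ((h + 1 : ℕ) : ℝ))) fun s' => (M.V_mem_Icc hπ hh s').2
  have h0 : 0 ≤ ∫ s', M.V π (h + 1) s' ∂(M.P h (s, a)) :=
    integral_nonneg fun s' => (M.V_mem_Icc hπ hh s').1
  have := M.r_mem h s a
  simp only [integral_const, probReal_univ, one_smul, Nat.cast_add, Nat.cast_one] at h1
  exact ⟨add_nonneg this.1 h0, by rw [Qval]; linarith [this.2]⟩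

theorem Qval_le_Qstar (hπ : IsPolicy π) {h : ℕ} (hh : h < M.H) (s : S) (a : A) :
    M.Qval π h s a ≤ M.Qstar h s a :=
  le_ciSup (f := fun π : {π : ℕ → S → A → ℝ // IsPolicy π} => M.Qval π.1 h s a)
    ⟨M.H - h, by rintro _ ⟨π', rfl⟩; exact (M.Qval_mem_Icc π'.2 hh s a).2⟩ ⟨π, hπ⟩

theorem Vstarρ_le (hπ : IsPolicy π) {c : ℝ} (hc : 0 ≤ c)
    (h : ∀ π', IsPolicy π' → ∀ s, M.V π' 0 s ≤ M.V π 0 s + c) : M.Vstarρ ≤ M.Vρ π + c := by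
  have hb := (M.bddMeas_V hπ 0).add (BddMeas.const c)
  calc M.Vstarρ ≤ ∫ s, (M.V π 0 s + c) ∂M.ρ := by
        -- Measurability of `Vstar 0` is not needed: the smaller function only has to be
        -- nonnegative, since a non-integrable one has integral `0`.
        refine integral_mono_of_nonneg (Filter.Eventually.of_forall fun s => ?_)
          (hb.integrable _) (Filter.Eventually.of_forall fun s => ?_)
        · exact Real.iSup_nonneg fun π' => (M.V_mem_Icc π'.2 (Nat.zero_le _) s).1
        · exact Real.iSup_le (fun π' => h π'.1 π'.2 s)
            (add_nonneg (M.V_mem_Icc hπ (Nat.zero_le _) s).1 hc)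
    _ = M.Vρ π + c := by
        rw [integral_add ((M.bddMeas_V hπ 0).integrable _) (integrable_const c)]
        simp [Vρ]

theorem Vstarρ_le_horizon (hπ : IsPolicy π) : M.Vstarρ ≤ M.Vρ π + M.H :=
  M.Vstarρ_le hπ (Nat.cast_nonneg _) fun π' hπ' s => by
    have h1 := (M.V_mem_Icc hπ' (Nat.zero_le _) s).2
    have h2 := (M.V_mem_Icc hπ (Nat.zero_le _) s).1
    simp only [Nat.cast_zero, sub_zero] at h1
    linarith

theorem regret_le_horizon_mul {T : ℕ} {p : ℕ → ℕ → S → A → ℝ} (hp : ∀ t < T, IsPolicy (p t)) :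
    M.regret T p ≤ M.H * T := by
  calc M.regret T p ≤ ∑ t ∈ Finset.range T, (M.H : ℝ) :=
        Finset.sum_le_sum fun t ht => by
          linarith [M.Vstarρ_le_horizon (hp t (Finset.mem_range.1 ht))]
    _ = M.H * T := by rw [Finset.sum_const, Finset.card_range, nsmul_eq_mul, mul_comm]

end Values

end EpisodicMDP

/-! ### Softmax policies: near-greediness and stability. -/

section Softmax

variable {S A : Type*} [Fintype A]

theorem softmax_mem_simplex [Nonempty A] (B : ℝ) (q : S → A → ℝ) (s : S) :
    softmax B q s ∈ stdSimplex ℝ A := by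
  have hpos : 0 < ∑ a', Real.exp (B * q s a') :=
    Finset.sum_pos (fun _ _ => Real.exp_pos _) Finset.univ_nonempty
  refine ⟨fun a => div_nonneg (Real.exp_pos _).le hpos.le, ?_⟩
  simp only [softmax]
  rw [← Finset.sum_div, div_self hpos.ne']

theorem measurable_softmax [MeasurableSpace S] (B : ℝ) {q : S → A → ℝ}
    (hq : ∀ a, Measurable fun s => q s a) (a : A) : Measurable fun s => softmax B q s a := by
  unfold softmax
  exact (((hq a).const_mul B).exp).div
    (Finset.measurable_sum _ fun a' _ => ((hq a').const_mul B).exp)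

/-- The softmax policy is greedy up to `log |A| / B`. -/
theorem le_softmax_sum_add [Nonempty A] {B : ℝ} (hB : 0 < B) (q : S → A → ℝ) (s : S) (a : A) :
    q s a ≤ ∑ a', softmax B q s a' * q s a' + Real.log (Fintype.card A) / B := by
  set Z := ∑ a', Real.exp (B * q s a') with hZ
  have hpos : 0 < Z := Finset.sum_pos (fun _ _ => Real.exp_pos _) Finset.univ_nonempty
  have hp := softmax_mem_simplex B q s
  have hppos : ∀ b, 0 < softmax B q s b := fun b => div_pos (Real.exp_pos _) hpos
  have hcard : (0 : ℝ) < Fintype.card A := Nat.cast_pos.2 Fintype.card_pos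
  -- Gibbs identity: `B` times the softmax average of `q` is `log Z` minus the entropy. Here `log Z`
  -- dominates `B * q s a`, and the entropy is at most `log |A|`.
  have h1 : B * q s a ≤ Real.log Z := by
    rw [Real.le_log_iff_exp_le hpos]
    exact Finset.single_le_sum (f := fun b => Real.exp (B * q s b))
      (fun b _ => (Real.exp_pos _).le) (Finset.mem_univ a)
  have h2 : ∀ b, B * q s b = Real.log (softmax B q s b) + Real.log Z := fun b => by
    rw [softmax, Real.log_div (Real.exp_pos _).ne' hpos.ne', Real.log_exp]
    ring
  -- The inequality `log y ≤ y - 1` at `y = 1 / (|A| p)`; summed over `b` it bounds the entropy by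
  -- `log |A|`.
  have h3 : ∀ b, softmax B q s b * -Real.log (softmax B q s b) ≤
      softmax B q s b * (Real.log (Fintype.card A) - 1) + 1 / Fintype.card A := fun b => by
    have := Real.log_le_sub_one_of_pos (x := 1 / (Fintype.card A * softmax B q s b))
      (by have := hppos b; positivity)
    rw [Real.log_div one_ne_zero (mul_pos hcard (hppos b)).ne', Real.log_one,
      Real.log_mul hcard.ne' (hppos b).ne'] at this
    have := mul_le_mul_of_nonneg_left this (hppos b).le
    have e : softmax B q s b * (1 / (Fintype.card A * softmax B q s b) - 1) =
        1 / Fintype.card A - softmax B q s b := by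
      have := (hppos b).ne'
      field_simp
    rw [e] at this
    linarith
  have h4 : ∑ b, softmax B q s b * -Real.log (softmax B q s b) ≤ Real.log (Fintype.card A) := by
    refine (Finset.sum_le_sum fun b _ => h3 b).trans ?_
    rw [Finset.sum_add_distrib, ← Finset.sum_mul, hp.2, Finset.sum_const, Finset.card_univ,
      nsmul_eq_mul, mul_one_div, div_self hcard.ne']
    linarith
  have h5 : B * ∑ b, softmax B q s b * q s b =
      Real.log Z - ∑ b, softmax B q s b * -Real.log (softmax B q s b) := by
    calc B * ∑ b, softmax B q s b * q s b
        = ∑ b, (softmax B q s b * Real.log Z - softmax B q s b * -Real.log (softmax B q s b)) := by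
          rw [Finset.mul_sum]
          refine Finset.sum_congr rfl fun b _ => ?_
          rw [mul_left_comm, h2 b]
          ring
      _ = _ := by rw [Finset.sum_sub_distrib, ← Finset.sum_mul, hp.2, one_mul]
  rw [← sub_le_iff_le_add', le_div_iff₀ hB]
  linarith

/-- Softmax policies depend Lipschitz continuously on the function. -/
theorem abs_softmax_sub_le [Nonempty A] {B ε : ℝ} (hB : 0 < B) (hε : 0 ≤ ε) (hε2 : ε ≤ 1 / 2)
    {q q' : S → A → ℝ} {s : S} (hq : ∀ a, |q s a - q' s a| ≤ ε / B) (a : A) :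
    |softmax B q s a - softmax B q' s a| ≤ 4 * ε * (softmax B q s a + softmax B q' s a) := by
  -- Numerator and normalizer each change by a factor of at most `exp ε`. A relative bound of this
  -- kind sums over the actions to `8 * ε`, independently of `|A|`.
  have key : ∀ q q' : S → A → ℝ, (∀ a, |q s a - q' s a| ≤ ε / B) →
      softmax B q s a ≤ Real.exp (2 * ε) * softmax B q' s a := by
    intro q q' hq
    have hpos : ∀ q : S → A → ℝ, 0 < ∑ a', Real.exp (B * q s a') := fun q =>
      Finset.sum_pos (fun _ _ => Real.exp_pos _) Finset.univ_nonempty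
    have hqB : ∀ b, B * |q s b - q' s b| ≤ ε := fun b => by
      have := mul_le_mul_of_nonneg_left (hq b) hB.le
      rwa [mul_div_cancel₀ _ hB.ne'] at this
    have h1 : ∀ b, Real.exp (B * q s b) ≤ Real.exp ε * Real.exp (B * q' s b) := fun b => by
      rw [← Real.exp_add, Real.exp_le_exp]
      nlinarith [hqB b, le_abs_self (q s b - q' s b)]
    have h2 : ∑ b, Real.exp (B * q' s b) ≤ Real.exp ε * ∑ b, Real.exp (B * q s b) := by
      rw [Finset.mul_sum]
      refine Finset.sum_le_sum fun b _ => ?_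
      rw [← Real.exp_add, Real.exp_le_exp]
      nlinarith [hqB b, neg_abs_le (q s b - q' s b)]
    rw [softmax, softmax, div_le_iff₀ (hpos q), mul_div_assoc', div_mul_eq_mul_div,
      le_div_iff₀ (hpos q')]
    calc Real.exp (B * q s a) * ∑ b, Real.exp (B * q' s b)
        ≤ (Real.exp ε * Real.exp (B * q' s a)) * (Real.exp ε * ∑ b, Real.exp (B * q s b)) :=
          mul_le_mul (h1 a) h2 (hpos q').le (by positivity)
      _ = Real.exp (2 * ε) * Real.exp (B * q' s a) * ∑ b, Real.exp (B * q s b) := by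
          rw [two_mul, Real.exp_add]; ring
  have he : Real.exp (2 * ε) ≤ 1 + 4 * ε := by
    have := Real.abs_exp_sub_one_le (x := 2 * ε) (by rw [abs_of_nonneg (by linarith)]; linarith)
    rw [abs_of_nonneg (by linarith : 0 ≤ 2 * ε)] at this
    linarith [le_abs_self (Real.exp (2 * ε) - 1)]
  have n1 := (softmax_mem_simplex B q s).1 a
  have n2 := (softmax_mem_simplex B q' s).1 a
  have k1 := key q q' hq
  have k2 := key q' q fun b => by rw [abs_sub_comm]; exact hq b
  rw [abs_le]
  constructor <;> nlinarith [mul_nonneg hε n1, mul_nonneg hε n2,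
    mul_le_mul_of_nonneg_right he n1, mul_le_mul_of_nonneg_right he n2]

end Softmax

end VAC

namespace VAC
namespace EpisodicMDP

variable {S A : Type*} [MeasurableSpace S] [MeasurableSpace A] [MeasurableSingletonClass A]
  [Fintype A] (M : EpisodicMDP S A)

/-! ### A Bellman-consistent, nearly optimal comparator. -/

section Comparator

variable {Q : ℕ → Set (S → A → ℝ)} {B : ℝ} {π : ℕ → S → A → ℝ}

/-- The softmax policy of the optimal action values. -/
noncomputable def softStar (B : ℝ) (h : ℕ) : S → A → ℝ :=
  -- Beyond the horizon nothing is assumed about `Qstar`; the uniform policy keeps the profile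
  -- measurable.
  if h < M.H then softmax B (M.Qstar h) else softmax B 0

omit [MeasurableSingletonClass A] in
theorem softStar_mem [Nonempty A] (hQ : M.QClassAssumption Q B) : M.softStar B ∈ M.PClass Q B := by
  refine ⟨⟨fun h s => ?_, fun h a => ?_⟩, fun h hh => ⟨_, hQ.realizable h hh, if_pos hh⟩⟩
  · unfold softStar
    split_ifs
    exacts [softmax_mem_simplex _ _ _, softmax_mem_simplex _ _ _]
  · unfold softStar
    split_ifs with hh
    exacts [measurable_softmax B (hQ.measurable h hh _ (hQ.realizable h hh)) a,
      measurable_softmax B (fun _ => measurable_const) a]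

/-- The softmax policy of the optimal action values loses at most `log |A| / B` per step. -/
theorem V_le_V_softStar_add [Nonempty A] (hQ : M.QClassAssumption Q B) (hB : 0 < B)
    (hπ : IsPolicy π) {h : ℕ} (hh : h ≤ M.H) (s : S) :
    M.V π h s ≤ M.V (M.softStar B) h s + (M.H - h) * (Real.log (Fintype.card A) / B) := by
  have hp := (M.softStar_mem hQ).1
  induction hh using Nat.decreasingInduction generalizing s π with
  | self => simp [M.V_of_le hπ le_rfl, M.V_of_le hp le_rfl]
  | of_succ k hk ih =>
    set κ := Real.log (Fintype.card A) / B with hκ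
    -- The induction hypothesis holds for every competitor, so it passes to the supremum; no optimal
    -- policy and no Bellman optimality equation are needed.
    have h1 : ∀ a, M.Qstar k s a ≤ M.Qval (M.softStar B) k s a + (M.H - (k + 1)) * κ := by
      intro a
      have : Nonempty {π : ℕ → S → A → ℝ // IsPolicy π} := ⟨⟨_, hp⟩⟩
      refine ciSup_le fun π' => ?_
      have := integral_mono ((M.bddMeas_V π'.2 (k + 1)).integrable (M.P k (s, a)))
        (((M.bddMeas_V hp (k + 1)).add (BddMeas.const _)).integrable (M.P k (s, a)))
        fun s' => ih π'.2 s'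
      rw [integral_add ((M.bddMeas_V hp _).integrable _) (integrable_const _)] at this
      simp only [integral_const, probReal_univ, one_smul, Nat.cast_add, Nat.cast_one] at this
      simp only [Qval]
      linarith
    have h2 : ∑ a, M.softStar B k s a * M.Qstar k s a ≤
        M.V (M.softStar B) k s + (M.H - (k + 1)) * κ := by
      rw [M.V_eq_sum_Qval hp hk]
      refine (Finset.sum_le_sum fun a _ =>
        mul_le_mul_of_nonneg_left (h1 a) ((hp.mem_simplex k s).1 a)).trans_eq ?_
      simp only [mul_add, Finset.sum_add_distrib]
      rw [← Finset.sum_mul, (hp.mem_simplex k s).2, one_mul]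
    rw [M.V_eq_sum_Qval hπ hk]
    refine simplex_sum_le (hπ.mem_simplex k s) fun a => ?_
    have h3 := M.Qval_le_Qstar hπ hk s a
    have h4 := le_softmax_sum_add hB (M.Qstar k) s a
    rw [← show M.softStar B k = softmax B (M.Qstar k) from if_pos hk] at h4
    linarith

/-- Bellman completeness yields the action values of the policies of the class. -/
theorem exists_mem_QClass_eq_Qval (hQ : M.QClassAssumption Q B) (hπ : π ∈ M.PClass Q B) :
    ∃ f ∈ M.QClass Q, ∀ h < M.H, f h = M.Qval π h := by
  -- Starting from `Qstar`, which serves only as a seed, `k` applications of the Bellman operator of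
  -- `π` make the last `k` steps correct.
  have key : ∀ k ≤ M.H, ∃ f ∈ M.QClass Q, ∀ h < M.H, M.H ≤ h + k → f h = M.Qval π h := by
    intro k
    induction k with
    | zero =>
      intro _
      refine ⟨fun h => if h < M.H then M.Qstar h else 0, ⟨fun h hh => ?_, fun h hh => ?_⟩,
        fun h hh hk => absurd hk (by omega)⟩
      · simp only [if_pos hh]
        exact hQ.realizable h hh
      · simp only [if_neg (not_lt.2 hh)]
    | succ k ih =>
      intro hk
      obtain ⟨f, hf, hfk⟩ := ih (by omega)
      refine ⟨fun h => if h < M.H then M.bellman π f h else 0, ⟨fun h hh => ?_, fun h hh => ?_⟩,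
        fun h hh hk => ?_⟩
      · simp only [if_pos hh]
        exact hQ.complete π hπ f hf h hh
      · simp only [if_neg (not_lt.2 hh)]
      · simp only [if_pos hh]
        funext s a
        refine congrArg (M.r h s a + ·) (integral_congr_ae (Filter.Eventually.of_forall fun s' => ?_))
        rcases Nat.lt_or_ge (h + 1) M.H with h1 | h1
        · simp only [hfk (h + 1) h1 (by omega), M.V_eq_sum_Qval hπ.1 h1]
        · simp [hf.2 (h + 1) h1, M.V_of_le hπ.1 h1]
  obtain ⟨f, hf, h⟩ := key M.H le_rfl
  exact ⟨f, hf, fun k hk => h k hk (by omega)⟩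

/-- The critic is the action value of the softmax policy rather than `Qstar`, so that its Bellman
error under that policy vanishes exactly; the price is the softmax gap in the value. -/
theorem exists_comparator [Nonempty A] (hQ : M.QClassAssumption Q B) (hB : 0 < B) :
    ∃ f ∈ M.QClass Q, ∃ π ∈ M.PClass Q B, (∀ h < M.H, M.bellman π f h = f h) ∧
      M.Vstarρ ≤ M.Vf f π + M.H * (Real.log (Fintype.card A) / B) := by
  have hm := M.softStar_mem hQ
  obtain ⟨f, hf, hfQ⟩ := M.exists_mem_QClass_eq_Qval hQ hm
  refine ⟨f, hf, M.softStar B, hm, fun h hh => ?_, ?_⟩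
  · rw [hfQ h hh]
    funext s a
    refine congrArg (M.r h s a + ·) (integral_congr_ae (Filter.Eventually.of_forall fun s' => ?_))
    rcases Nat.lt_or_ge (h + 1) M.H with h1 | h1
    · simp only [hfQ (h + 1) h1, M.V_eq_sum_Qval hm.1 h1]
    · simp [hf.2 (h + 1) h1, M.V_of_le hm.1 h1]
  · have : M.Vf f (M.softStar B) = M.Vρ (M.softStar B) := by
      simp only [Vf, Vρ, hfQ 0 M.H_pos, M.V_eq_sum_Qval hm.1 M.H_pos]
    rw [this]
    refine M.Vstarρ_le hm.1 ?_ fun π' hπ' s => ?_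
    · exact mul_nonneg (Nat.cast_nonneg _) (div_nonneg (Real.log_natCast_nonneg _) hB.le)
    · simpa using M.V_le_V_softStar_add hQ hB hπ' (Nat.zero_le _) s

end Comparator

end EpisodicMDP
end VAC

namespace VAC

/-! ### Exponential inequalities for adaptively sampled data. -/

section ConditionalLaw

open Filter Topology

variable {Ω E : Type*} {m mΩ : MeasurableSpace Ω} [MeasurableSpace E] {μ : Measure Ω}
  [IsProbabilityMeasure μ]

theorem condExp_simpleFunc_comp_eq {X : Ω → E}
    (hX : Measurable X) {κ : Ω → Measure E} (hκ : ∀ ω, IsProbabilityMeasure (κ ω))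
    (hlaw : ∀ s : Set E, MeasurableSet s →
      μ[(X ⁻¹' s).indicator (fun _ => (1 : ℝ)) | m] =ᵐ[μ] fun ω => (κ ω).real s)
    (g : SimpleFunc E ℝ) :
    μ[fun ω => g (X ω) | m] =ᵐ[μ] fun ω => ∫ x, g x ∂κ ω := by
  have hint : ∀ g : SimpleFunc E ℝ, Integrable (fun ω => g (X ω)) μ := fun g =>
    (SimpleFunc.integrable_of_isFiniteMeasure (g.comp X hX))
  induction g using SimpleFunc.induction with
  | const c hs =>
    rename_i s
    have e : (fun ω => (SimpleFunc.piecewise s hs (SimpleFunc.const E c) (SimpleFunc.const E 0))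
        (X ω)) = c • (X ⁻¹' s).indicator (fun _ => (1 : ℝ)) := by
      funext ω
      by_cases h : X ω ∈ s <;> simp [h]
    have e' : ∀ ω, ∫ x, (SimpleFunc.piecewise s hs (SimpleFunc.const E c) (SimpleFunc.const E 0)) x
        ∂κ ω = c * (κ ω).real s := by
      intro ω
      rw [SimpleFunc.coe_piecewise, SimpleFunc.coe_const, SimpleFunc.coe_const]
      classical
      rw [show Function.const E (0 : ℝ) = 0 from rfl, Set.piecewise_eq_indicator]
      change ∫ x, s.indicator (fun _ => c) x ∂κ ω = _
      rw [integral_indicator_const _ hs, smul_eq_mul, mul_comm]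
    rw [e]
    filter_upwards [condExp_smul (μ := μ) c ((X ⁻¹' s).indicator fun _ => (1 : ℝ)) m, hlaw s hs]
      with ω h1 h2
    rw [h1, Pi.smul_apply, h2, e', smul_eq_mul]
  | add _ h1 h2 =>
    rename_i f g _
    filter_upwards [condExp_add (hint f) (hint g) m, h1, h2] with ω h3 h4 h5
    have e : (fun ω => (f + g) (X ω)) = (fun ω => f (X ω)) + fun ω => g (X ω) := rfl
    rw [e, h3, Pi.add_apply, h4, h5, ← integral_add
      (SimpleFunc.integrable_of_isFiniteMeasure f) (SimpleFunc.integrable_of_isFiniteMeasure g)]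
    rfl

/-- Conditional expectations of bounded functions are integrals against the conditional law. -/
theorem condExp_comp_eq (hm : m ≤ mΩ) {X : Ω → E}
    (hX : Measurable X) {κ : Ω → Measure E} (hκ : ∀ ω, IsProbabilityMeasure (κ ω))
    (hlaw : ∀ s : Set E, MeasurableSet s →
      μ[(X ⁻¹' s).indicator (fun _ => (1 : ℝ)) | m] =ᵐ[μ] fun ω => (κ ω).real s)
    {φ : E → ℝ} (hφ : BddMeas φ) :
    μ[fun ω => φ (X ω) | m] =ᵐ[μ] fun ω => ∫ x, φ x ∂κ ω := by
  obtain ⟨C, hC⟩ := hφ.bdd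
  have hne : Nonempty E := by
    obtain ⟨ω⟩ := nonempty_of_isProbabilityMeasure μ
    exact nonempty_of_isProbabilityMeasure (κ ω)
  have hC0 : 0 ≤ C := (abs_nonneg _).trans (hC hne.some)
  have hsm := hφ.meas.stronglyMeasurable
  set g := hsm.approxBounded C
  have hgb : ∀ n x, ‖g n x‖ ≤ C := hsm.norm_approxBounded_le hC0
  have hgt : ∀ x, Tendsto (fun n => g n x) atTop (𝓝 (φ x)) := fun x =>
    hsm.tendsto_approxBounded_of_norm_le (hC x)
  have hs := fun n => condExp_simpleFunc_comp_eq hX hκ hlaw (g n)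
  -- The family `κ` is not assumed to be a kernel: its integrals inherit measurability from the
  -- conditional expectations, first for simple functions and then in the limit.
  have hmeas : ∀ n, AEStronglyMeasurable[m] (fun ω => ∫ x, g n x ∂κ ω) μ := fun n =>
    stronglyMeasurable_condExp.aestronglyMeasurable.congr (hs n)
  have hgi : ∀ n, Integrable (fun ω => ∫ x, g n x ∂κ ω) μ := fun n =>
    integrable_condExp.congr (hs n)
  have hlim : ∀ ω, Tendsto (fun n => ∫ x, g n x ∂κ ω) atTop (𝓝 (∫ x, φ x ∂κ ω)) := fun ω =>
    tendsto_integral_of_dominated_convergence (fun _ => C)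
      (fun n => (g n).stronglyMeasurable.aestronglyMeasurable) (integrable_const C)
      (fun n => Eventually.of_forall (hgb n)) (Eventually.of_forall hgt)
  have hφm : AEStronglyMeasurable[m] (fun ω => ∫ x, φ x ∂κ ω) μ :=
    ⟨_, (Measurable.limsup fun n => (hmeas n).stronglyMeasurable_mk.measurable).stronglyMeasurable,
      by
        filter_upwards [ae_all_iff.2 fun n => (hmeas n).ae_eq_mk] with ω h
        rw [← (hlim ω).limsup_eq]
        simp_rw [h]⟩
  have hφi : Integrable (fun ω => ∫ x, φ x ∂κ ω) μ :=
    Integrable.of_bound (hφm.mono hm) C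
      (Eventually.of_forall fun ω => BddMeas.abs_integral_le hC _)
  refine (tendsto_condExp_unique (fun n ω => g n (X ω)) (fun n ω => ∫ x, g n x ∂κ ω)
    (fun ω => φ (X ω)) (fun ω => ∫ x, φ x ∂κ ω)
    (fun n => SimpleFunc.integrable_of_isFiniteMeasure ((g n).comp X hX)) hgi
    (Eventually.of_forall fun ω => hgt _) (Eventually.of_forall hlim) (fun _ => C)
    (integrable_const C) (fun _ => C) (integrable_const C)
    (fun n => Eventually.of_forall fun ω => hgb n _)
    (fun n => Eventually.of_forall fun ω => BddMeas.abs_integral_le (hgb n) _)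
    fun n => (hs n).trans
      (condExp_of_aestronglyMeasurable' hm (hmeas n) (hgi n)).symm).trans ?_
  exact condExp_of_aestronglyMeasurable' hm hφm hφi

/-- A Chernoff bound for adaptively sampled data: `κ t` is the conditional law of `τ t`. -/
theorem measure_le_exp_neg_of_conditional {ℱ : Filtration ℕ mΩ} {τ : ℕ → Ω → E}
    {κ : ℕ → Ω → Measure E} {T : ℕ} (hκ : ∀ t < T, ∀ ω, IsProbabilityMeasure (κ t ω))
    (hτ : ∀ t < T, Measurable[ℱ (t + 1)] (τ t))
    (hlaw : ∀ t < T, ∀ s : Set E, MeasurableSet s →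
      μ[(τ t ⁻¹' s).indicator (fun _ => (1 : ℝ)) | ℱ t] =ᵐ[μ] fun ω => (κ t ω).real s)
    {φ ψ : E → ℝ} (hφ : BddMeas φ) (hψ : BddMeas ψ)
    (hexp : ∀ t < T, ∀ ω,
      ∫ x, Real.exp (-φ x) ∂κ t ω ≤ Real.exp (-∫ x, ψ x ∂κ t ω))
    {t : ℕ} (ht : t ≤ T) (x : ℝ) :
    μ {ω | x ≤ ∑ i ∈ Finset.range t, (∫ y, ψ y ∂κ i ω - φ (τ i ω))} ≤
      ENNReal.ofReal (Real.exp (-x)) := by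
  have hτ' : ∀ t < T, Measurable (τ t) := fun t ht => (hτ t ht).mono (ℱ.le _) le_rfl
  -- The conditional expectation is a version of `∫ ψ ∂κ` that is exactly adapted, as the process
  -- `W` below requires.
  set ξ : ℕ → Ω → ℝ := fun i => μ[fun ω => ψ (τ i ω) | ℱ i] with hξ
  have hξe : ∀ i < T, ξ i =ᵐ[μ] fun ω => ∫ y, ψ y ∂κ i ω := fun i hi =>
    condExp_comp_eq (ℱ.le i) (hτ' i hi) (hκ i hi) (hlaw i hi) hψ
  obtain ⟨C, hC⟩ := hφ.bdd
  obtain ⟨D, hD⟩ := hψ.bdd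
  set W : ℕ → Ω → ℝ := fun t ω => Real.exp (∑ i ∈ Finset.range t, (ξ i ω - φ (τ i ω))) with hW
  -- `W` is a positive supermartingale starting at `1`: by `hexp` the conditional mean of each new
  -- factor is at most `1`. Markov's inequality then finishes the proof.
  have key : ∀ t ≤ T, StronglyMeasurable[ℱ t] (W t) ∧ (∃ K, ∀ᵐ ω ∂μ, ‖W t ω‖ ≤ K) ∧
      ∫ ω, W t ω ∂μ ≤ 1 := by
    intro t
    induction t with
    | zero =>
      intro _
      refine ⟨?_, ⟨1, ?_⟩, ?_⟩ <;> simp [hW, stronglyMeasurable_const]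
    | succ t ih =>
      intro ht
      obtain ⟨h1, ⟨K, hK⟩, h3⟩ := ih (by omega)
      have hξt := hξe t ht
      have hsucc : W (t + 1) = (fun ω => W t ω * Real.exp (ξ t ω)) *
          fun ω => Real.exp (-φ (τ t ω)) := by
        funext ω
        simp only [hW, Pi.mul_apply, Finset.sum_range_succ, ← Real.exp_add]
        congr 1
        ring
      have hfm : StronglyMeasurable[ℱ t] fun ω => W t ω * Real.exp (ξ t ω) :=
        h1.mul (Real.continuous_exp.comp_stronglyMeasurable stronglyMeasurable_condExp)
      have hφe := hφ.meas.neg.exp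
      have hbe : BddMeas fun y => Real.exp (-φ y) := by
        simpa using ((BddMeas.const (0 : ℝ)).sub hφ).exp
      have hgi : Integrable (fun ω => Real.exp (-φ (τ t ω))) μ :=
        (hbe.comp (hτ' t ht)).integrable μ
      have hfb : ∀ᵐ ω ∂μ, ‖W t ω * Real.exp (ξ t ω)‖ ≤ K * Real.exp D := by
        filter_upwards [hK, hξt] with ω h h'
        rw [norm_mul]
        refine mul_le_mul h ?_ (norm_nonneg _) ((norm_nonneg _).trans h)
        rw [Real.norm_of_nonneg (Real.exp_pos _).le, h']
        have := hκ t ht ω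
        exact Real.exp_le_exp.2 ((le_abs_self _).trans (BddMeas.abs_integral_le hD _))
      refine ⟨?_, ⟨K * Real.exp D * Real.exp C, ?_⟩, ?_⟩
      · rw [hsucc]
        exact (hfm.mono (ℱ.mono t.le_succ)).mul ((hφe.comp (hτ t ht)).stronglyMeasurable)
      · filter_upwards [hfb] with ω h
        rw [hsucc, Pi.mul_apply, norm_mul]
        refine mul_le_mul h ?_ (norm_nonneg _) ((norm_nonneg _).trans h)
        rw [Real.norm_of_nonneg (Real.exp_pos _).le]
        exact Real.exp_le_exp.2 ((neg_le_abs _).trans (hC _))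
      · have hpull := condExp_stronglyMeasurable_mul_of_bound (ℱ.le t) hfm hgi _ hfb
        have hce := condExp_comp_eq (ℱ.le t) (hτ' t ht) (hκ t ht) (hlaw t ht) hbe
        refine le_trans ?_ h3
        rw [← integral_condExp (ℱ.le t) (f := W (t + 1)), hsucc]
        refine integral_mono_ae integrable_condExp
          (Integrable.of_bound (h1.mono (ℱ.le t)).aestronglyMeasurable K hK) ?_
        filter_upwards [hpull, hce, hξt] with ω e1 e2 e3
        rw [e1, Pi.mul_apply, e2, e3]
        have := hexp t ht ω
        calc W t ω * Real.exp (∫ y, ψ y ∂κ t ω) * ∫ y, Real.exp (-φ y) ∂κ t ω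
            ≤ W t ω * Real.exp (∫ y, ψ y ∂κ t ω) * Real.exp (-∫ y, ψ y ∂κ t ω) :=
              mul_le_mul_of_nonneg_left this (mul_pos (Real.exp_pos _) (Real.exp_pos _)).le
          _ = W t ω := by rw [mul_assoc, ← Real.exp_add, add_neg_cancel, Real.exp_zero, mul_one]
  obtain ⟨h1, ⟨K, hK⟩, h3⟩ := key t ht
  have hWi : Integrable (W t) μ :=
    Integrable.of_bound (h1.mono (ℱ.le t)).aestronglyMeasurable K hK
  have hall : ∀ᵐ ω ∂μ, ∀ i ∈ Finset.range t, ξ i ω = ∫ y, ψ y ∂κ i ω :=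
    (Finset.eventually_all _).2 fun i hi =>
      hξe i ((Finset.mem_range.1 hi).trans_le ht)
  have hle : μ {ω | x ≤ ∑ i ∈ Finset.range t, (∫ y, ψ y ∂κ i ω - φ (τ i ω))} ≤
      μ {ω | Real.exp x ≤ W t ω} := by
    refine measure_mono_ae ?_
    filter_upwards [hall] with ω h hx
    refine Real.exp_le_exp.2 (hx.trans_eq (Finset.sum_congr rfl fun i hi => ?_))
    rw [h i hi]
  have hmk := mul_meas_ge_le_integral_of_nonneg
    (Eventually.of_forall fun ω => (Real.exp_pos _).le) hWi (Real.exp x)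
  refine hle.trans ?_
  rw [← ofReal_measureReal]
  refine ENNReal.ofReal_le_ofReal ?_
  rw [Real.exp_neg, ← one_div, le_div_iff₀ (Real.exp_pos x), mul_comm]
  exact hmk.trans h3

/-- The exponential moment bound behind Bernstein's inequality. -/
theorem integral_exp_neg_le {ν : Measure E} [IsProbabilityMeasure ν] {Z v : E → ℝ} {c K : ℝ}
    (hc : 0 ≤ c) (hZ : BddMeas Z) (hcZ : ∀ x, c * |Z x| ≤ 1)
    (hmean : ∫ x, Z x ∂ν = ∫ x, v x ∂ν) (hsq : ∫ x, Z x ^ 2 ∂ν ≤ K * ∫ x, v x ∂ν)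
    (hm0 : ∀ x, 0 ≤ v x) (hcK : c * K ≤ 1 / 2) :
    ∫ x, Real.exp (-(c * Z x)) ∂ν ≤ Real.exp (-∫ x, c / 2 * v x ∂ν) := by
  -- The bound `exp (-y) ≤ 1 - y + y²` for `|y| ≤ 1`. Since `c * K ≤ 1 / 2`, the quadratic term
  -- consumes at most half of the linear one.
  have hpt : ∀ x, Real.exp (-(c * Z x)) ≤ 1 - c * Z x + c ^ 2 * Z x ^ 2 := by
    intro x
    have habs : |-(c * Z x)| ≤ 1 := by
      rw [abs_neg, abs_mul, abs_of_nonneg hc]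
      exact hcZ x
    have := (le_abs_self _).trans (Real.abs_exp_sub_one_sub_id_le habs)
    nlinarith
  have hZi := hZ.integrable ν
  have hZ2 := (hZ.pow 2).integrable ν
  have he : BddMeas fun x => Real.exp (-(c * Z x)) := by
    simpa using ((BddMeas.const (-c)).mul hZ).exp
  have hmi : 0 ≤ ∫ x, v x ∂ν := integral_nonneg hm0
  have h1 : ∫ x, (1 - c * Z x + c ^ 2 * Z x ^ 2) ∂ν =
      1 - c * ∫ x, Z x ∂ν + c ^ 2 * ∫ x, Z x ^ 2 ∂ν := by
    have e1 : Integrable (fun x => 1 - c * Z x) ν := (integrable_const _).sub (hZi.const_mul c)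
    rw [integral_add e1 (hZ2.const_mul _),
      integral_sub (integrable_const _) (hZi.const_mul c), integral_const_mul, integral_const_mul]
    simp
  have hb : BddMeas fun x => 1 - c * Z x + c ^ 2 * Z x ^ 2 :=
    ((BddMeas.const _).sub ((BddMeas.const _).mul hZ)).add ((BddMeas.const _).mul (hZ.pow 2))
  have h2 := integral_mono (he.integrable ν) (hb.integrable ν) hpt
  rw [h1] at h2
  refine h2.trans ?_
  rw [integral_const_mul]
  refine le_trans ?_ (Real.add_one_le_exp _)
  rw [hmean]
  have h3 : c ^ 2 * ∫ x, Z x ^ 2 ∂ν ≤ c ^ 2 * (K * ∫ x, v x ∂ν) :=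
    mul_le_mul_of_nonneg_left hsq (sq_nonneg c)
  have h4 : c * (c * K) * ∫ x, v x ∂ν ≤ c * (1 / 2) * ∫ x, v x ∂ν :=
    mul_le_mul_of_nonneg_right (mul_le_mul_of_nonneg_left hcK hc) hmi
  nlinarith

end ConditionalLaw

end VAC

namespace VAC
namespace EpisodicMDP

variable {S A : Type*} [MeasurableSpace S] [MeasurableSpace A] [MeasurableSingletonClass A]
  [Fintype A] (M : EpisodicMDP S A)

/-! ### Excess squared losses and their deviations. -/

section Excess

/-- The expected reward plus next value `v` after a step. -/
noncomputable def backup (h : ℕ) (v : S → ℝ) (s : S) (a : A) : ℝ :=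
  M.r h s a + ∫ s', v s' ∂(M.P h (s, a))

/-- The excess squared loss `(y - g)² - (y - 𝔼 y)²` of the prediction `g` of `y = r + v(s')`. -/
noncomputable def excess (h : ℕ) (v : S → ℝ) (g : S → A → ℝ) (x : S × A × S) : ℝ :=
  (M.backup h v x.1 x.2.1 - g x.1 x.2.1) *
    (2 * (M.r h x.1 x.2.1 + v x.2.2) - g x.1 x.2.1 - M.backup h v x.1 x.2.1)

/-- The squared error of `g` as a prediction of the backup of `v`. -/
noncomputable def resid (h : ℕ) (v : S → ℝ) (g : S → A → ℝ) (x : S × A) : ℝ :=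
  (M.backup h v x.1 x.2 - g x.1 x.2) ^ 2

variable {h : ℕ} {v v' : S → ℝ} {g g' : S → A → ℝ} {R : ℝ}

omit [MeasurableSingletonClass A] [Fintype A] in
theorem abs_reward_add_le {c : ℝ} (s : S) (a : A) (hc : |c| ≤ R - 1) : |M.r h s a + c| ≤ R := by
  have h2 := M.r_mem h s a
  rw [abs_le] at *
  constructor <;> linarith [h2.1, h2.2]

omit [MeasurableSingletonClass A] [Fintype A] in
theorem abs_backup_le (hvR : ∀ s, |v s| ≤ R - 1) (s : S) (a : A) : |M.backup h v s a| ≤ R :=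
  M.abs_reward_add_le s a (BddMeas.abs_integral_le hvR _)

theorem bddMeas_backup (hv : BddMeas v) : BddMeas fun x : S × A => M.backup h v x.1 x.2 :=
  (M.bddMeas_reward_prod h).add (hv.integral_kernel (M.P h))

theorem bddMeas_resid (hv : BddMeas v) (hg : BddMeas fun x : S × A => g x.1 x.2) :
    BddMeas (M.resid h v g) :=
  ((M.bddMeas_backup hv).sub hg).pow 2

theorem bddMeas_excess (hv : BddMeas v) (hg : BddMeas fun x : S × A => g x.1 x.2) :
    BddMeas (M.excess h v g) := by
  have hφ : Measurable fun x : S × A × S => (x.1, x.2.1) := by fun_prop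
  have hb := (M.bddMeas_backup (h := h) hv).comp hφ
  have hg' := hg.comp hφ
  have hr := (M.bddMeas_reward_prod h).comp hφ
  exact (hb.sub hg').mul ((((BddMeas.const 2).mul (hr.add (hv.comp
    (φ := fun x : S × A × S => x.2.2) (by fun_prop)))).sub hg').sub hb)

omit [MeasurableSingletonClass A] [Fintype A] in
-- The excess is affine in `v s'`, and `r + v s'` has conditional mean `backup`, so only the squared
-- bias survives.
theorem integral_excess (hv : BddMeas v) (s : S) (a : A) :
    ∫ s', M.excess h v g (s, a, s') ∂(M.P h (s, a)) = M.resid h v g (s, a) := by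
  have e : ∀ s', M.excess h v g (s, a, s') = (M.backup h v s a - g s a) * 2 * v s' +
      (M.backup h v s a - g s a) * (2 * M.r h s a - g s a - M.backup h v s a) := fun s' => by
    simp only [excess]
    ring
  simp_rw [e]
  rw [integral_add ((hv.integrable _).const_mul _) (integrable_const _), integral_const_mul]
  simp only [integral_const, probReal_univ, one_smul, resid, backup]
  ring

section Bounds

variable (hvR : ∀ s, |v s| ≤ R - 1) (hgR : ∀ s a, |g s a| ≤ R)

omit [MeasurableSingletonClass A] [Fintype A]

include hvR hgR in
theorem abs_backup_sub_le (s : S) (a : A) : |M.backup h v s a - g s a| ≤ 2 * R :=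
  (abs_sub _ _).trans (by linarith [M.abs_backup_le (h := h) hvR s a, hgR s a])

include hvR hgR in
theorem abs_two_mul_sub_le (s s' : S) (a : A) :
    |2 * (M.r h s a + v s') - g s a - M.backup h v s a| ≤ 4 * R := by
  have h1 := abs_le.1 (M.abs_reward_add_le (h := h) s a (hvR s'))
  have h2 := abs_le.1 (M.abs_backup_le (h := h) hvR s a)
  have h3 := abs_le.1 (hgR s a)
  rw [abs_le]
  constructor <;> linarith [h1.1, h1.2, h2.1, h2.2, h3.1, h3.2]

include hvR hgR in
theorem abs_excess_le (x : S × A × S) : |M.excess h v g x| ≤ 8 * R ^ 2 := by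
  have h1 := M.abs_backup_sub_le (h := h) hvR hgR x.1 x.2.1
  have h2 := M.abs_two_mul_sub_le (h := h) hvR hgR x.1 x.2.2 x.2.1
  rw [excess, abs_mul]
  calc _ ≤ (2 * R) * (4 * R) :=
        mul_le_mul h1 h2 (abs_nonneg _) ((abs_nonneg _).trans h1)
    _ = _ := by ring

include hvR hgR in
-- The self-bounding property behind the fast rate: the second moment is controlled by the mean, so
-- Bernstein's correction is absorbed by half of the mean and no `√t` term appears.
theorem excess_sq_le (x : S × A × S) :
    M.excess h v g x ^ 2 ≤ 16 * R ^ 2 * M.resid h v g (x.1, x.2.1) := by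
  have h2 := M.abs_two_mul_sub_le (h := h) hvR hgR x.1 x.2.2 x.2.1
  have h3 := sq_le_sq' (abs_le.1 h2).1 (abs_le.1 h2).2
  rw [excess, resid, mul_pow, mul_comm]
  calc _ ≤ (4 * R) ^ 2 * (M.backup h v x.1 x.2.1 - g x.1 x.2.1) ^ 2 :=
        mul_le_mul_of_nonneg_right h3 (sq_nonneg _)
    _ = _ := by ring

variable (hvR' : ∀ s, |v' s| ≤ R - 1) (hgR' : ∀ s a, |g' s a| ≤ R) {e₁ e₂ : ℝ}
  (hv : BddMeas v) (hv' : BddMeas v')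
  (he₁ : ∀ s, |v s - v' s| ≤ e₁) (he₂ : ∀ s a, |g s a - g' s a| ≤ e₂)

include hv hv' he₁ in
theorem abs_backup_sub_backup_le (s : S) (a : A) :
    |M.backup h v s a - M.backup h v' s a| ≤ e₁ := by
  rw [backup, backup, add_sub_add_left_eq_sub,
    ← integral_sub (hv.integrable _) (hv'.integrable _)]
  exact BddMeas.abs_integral_le he₁ _

include hvR hgR hvR' hgR' hv hv' he₁ he₂ in
theorem resid_le_add (x : S × A) :
    M.resid h v g x ≤ M.resid h v' g' x + 4 * R * (e₁ + e₂) := by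
  have h1 := abs_le.1 (M.abs_backup_sub_le (h := h) hvR hgR x.1 x.2)
  have h2 := abs_le.1 (M.abs_backup_sub_le (h := h) hvR' hgR' x.1 x.2)
  have h3 := abs_le.1 (M.abs_backup_sub_backup_le (h := h) hv hv' he₁ x.1 x.2)
  have h4 := abs_le.1 (he₂ x.1 x.2)
  rw [resid, resid]
  set a := M.backup h v x.1 x.2 - g x.1 x.2
  set b := M.backup h v' x.1 x.2 - g' x.1 x.2
  have h5 : |a - b| ≤ e₁ + e₂ := abs_le.2 ⟨by linarith, by linarith⟩
  have h6 : |a + b| ≤ 4 * R := abs_le.2 ⟨by linarith, by linarith⟩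
  have h7 := (le_abs_self ((a + b) * (a - b))).trans ((abs_mul _ _).trans_le
    (mul_le_mul h6 h5 (abs_nonneg _) ((abs_nonneg _).trans h6)))
  linarith

include hvR hgR hvR' hgR' hv hv' he₁ he₂ in
theorem excess_le_add (x : S × A × S) :
    M.excess h v' g' x ≤ M.excess h v g x + 10 * R * (e₁ + e₂) := by
  have h1 := M.abs_backup_sub_le (h := h) hvR hgR x.1 x.2.1
  have h2 := M.abs_two_mul_sub_le (h := h) hvR' hgR' x.1 x.2.2 x.2.1
  have h3 := abs_le.1 (M.abs_backup_sub_backup_le (h := h) hv hv' he₁ x.1 x.2.1)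
  have h4 := abs_le.1 (he₂ x.1 x.2.1)
  have h5 := abs_le.1 (he₁ x.2.2)
  have he : 0 ≤ e₂ := (abs_nonneg _).trans (he₂ x.1 x.2.1)
  rw [excess, excess]
  set a := M.backup h v x.1 x.2.1 - g x.1 x.2.1
  set b := M.backup h v' x.1 x.2.1 - g' x.1 x.2.1
  set w := 2 * (M.r h x.1 x.2.1 + v x.2.2) - g x.1 x.2.1 - M.backup h v x.1 x.2.1
  set w' := 2 * (M.r h x.1 x.2.1 + v' x.2.2) - g' x.1 x.2.1 - M.backup h v' x.1 x.2.1
  -- Split `b w' - a w = (b - a) w' + a (w' - w)`; the two parts cost `4R` and `2R · 3` times `e₁ +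
  -- e₂`.
  have h6 : |b - a| ≤ e₁ + e₂ := abs_le.2 ⟨by linarith, by linarith⟩
  have h7 : |w' - w| ≤ 3 * (e₁ + e₂) := abs_le.2 ⟨by linarith, by linarith⟩
  have h8 := (le_abs_self ((b - a) * w')).trans ((abs_mul _ _).trans_le
    (mul_le_mul h6 h2 (abs_nonneg _) ((abs_nonneg _).trans h6)))
  have h9 := (le_abs_self (a * (w' - w))).trans ((abs_mul _ _).trans_le
    (mul_le_mul h1 h7 (abs_nonneg _) ((abs_nonneg _).trans h1)))
  linarith

end Bounds

omit [MeasurableSingletonClass A] in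
theorem isProbabilityMeasure_occ {π : ℕ → S → A → ℝ} (hπ : IsPolicy π) (h : ℕ) :
    IsProbabilityMeasure (M.occ π h) := by
  have := M.isProbabilityMeasure_pathLaw hπ 0 M.ρ (h + 1)
  exact Measure.isProbabilityMeasure_map (by fun_prop)

omit [MeasurableSingletonClass A] in
theorem isProbabilityMeasure_trajLaw {π : ℕ → S → A → ℝ} (hπ : IsPolicy π) :
    IsProbabilityMeasure (M.trajLaw π) :=
  M.isProbabilityMeasure_pathLaw hπ 0 M.ρ M.H

omit [MeasurableSingletonClass A] in
-- The terms quadratic in `f (h + 1)` cancel, so `f` and `π` enter only through the averaged next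
-- value. Concentration therefore concerns pairs (next value, prediction).
theorem sqLoss_sub_sqLoss {π f : ℕ → S → A → ℝ} (hπ : IsPolicy π) (τ : ℕ → M.Traj) (t : ℕ)
    (h : Fin M.H) (g : S → A → ℝ) :
    M.sqLoss τ t f π h g - M.sqLoss τ t f π h (M.bellman π f h) =
      ∑ i ∈ Finset.range t, M.excess h (fun s => ∑ a, π (h + 1) s a * f (h + 1) s a) g
        ((τ i).1 h.castSucc, (τ i).2 h, (τ i).1 h.succ) := by
  rw [sqLoss, sqLoss, ← Finset.sum_sub_distrib]
  refine Finset.sum_congr rfl fun i _ => ?_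
  rw [← Finset.sum_sub_distrib]
  change _ = (M.bellman π f h ((τ i).1 h.castSucc) ((τ i).2 h) - g _ _) *
    (2 * (_ + ∑ a, _) - g _ _ - M.bellman π f h ((τ i).1 h.castSucc) ((τ i).2 h))
  simp only
  set b := M.bellman π f h ((τ i).1 h.castSucc) ((τ i).2 h)
  set r := M.r h ((τ i).1 h.castSucc) ((τ i).2 h)
  set y := g ((τ i).1 h.castSucc) ((τ i).2 h)
  have h1 := (hπ.mem_simplex (h + 1) ((τ i).1 h.succ)).2
  calc _ = ∑ a, ((b - y) * (2 * (π (h + 1) ((τ i).1 h.succ) a * f (h + 1) ((τ i).1 h.succ) a)) +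
        (b - y) * (2 * r - y - b) * π (h + 1) ((τ i).1 h.succ) a) :=
        Finset.sum_congr rfl fun a _ => by ring
    _ = _ := by
        rw [Finset.sum_add_distrib, ← Finset.mul_sum, ← Finset.mul_sum, ← Finset.mul_sum, h1]
        ring

theorem measure_excess_deviation {Ω : Type*} {mΩ : MeasurableSpace Ω} {μ : Measure Ω}
    [IsProbabilityMeasure μ] {ℱ : Filtration ℕ mΩ} {T : ℕ} {π : ℕ → Ω → ℕ → S → A → ℝ}
    {τ : ℕ → Ω → M.Traj} (hπ : ∀ t < T, ∀ ω, IsPolicy (π t ω))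
    (hτ : ∀ t < T, Measurable[ℱ (t + 1)] (τ t))
    (hlaw : ∀ t < T, ∀ E : Set M.Traj, MeasurableSet E →
      μ[(τ t ⁻¹' E).indicator (fun _ => (1 : ℝ)) | ℱ t] =ᵐ[μ]
        fun ω => (M.trajLaw (π t ω)).real E)
    (h : Fin M.H) {v : S → ℝ} {g : S → A → ℝ} {R : ℝ} (hR : 0 < R)
    (hv : BddMeas v) (hg : BddMeas fun x : S × A => g x.1 x.2)
    (hvR : ∀ s, |v s| ≤ R - 1) (hgR : ∀ s a, |g s a| ≤ R) {t : ℕ} (ht : t ≤ T) (x : ℝ) :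
    μ {ω | 32 * R ^ 2 * x ≤ ∑ i ∈ Finset.range t, (1 / 2 * ∫ z, M.resid h v g z ∂(M.occ (π i ω) h)
        - M.excess h v g ((τ i ω).1 h.castSucc, (τ i ω).2 h, (τ i ω).1 h.succ))} ≤
      ENNReal.ofReal (Real.exp (-x)) := by
  -- With this scale, `c` times the bound `8R²` on the excess is `1/4 ≤ 1`, and `c` times the
  -- variance factor `16R²` is exactly `1/2`.
  set c : ℝ := 1 / (32 * R ^ 2) with hc
  have hc0 : 0 < c := by positivity
  have hZ : BddMeas fun ω : M.Traj => M.excess h v g (ω.1 h.castSucc, ω.2 h, ω.1 h.succ) :=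
    (M.bddMeas_excess hv hg).comp (by fun_prop)
  have hm : BddMeas fun ω : M.Traj => M.resid h v g (ω.1 h.castSucc, ω.2 h) :=
    (M.bddMeas_resid hv hg).comp (by fun_prop)
  have hres : ∀ {p : ℕ → S → A → ℝ}, IsPolicy p →
      ∫ ω, M.resid h v g (ω.1 h.castSucc, ω.2 h) ∂(M.trajLaw p) =
        ∫ z, M.resid h v g z ∂(M.occ p h) := fun {p} hp => by
    have := M.integral_trajLaw_step hp h (F := fun x => M.resid h v g (x.1, x.2.1))
      ((M.bddMeas_resid hv hg).comp (by fun_prop))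
    simpa using this
  have hexc : ∀ {p : ℕ → S → A → ℝ}, IsPolicy p →
      ∫ ω, M.excess h v g (ω.1 h.castSucc, ω.2 h, ω.1 h.succ) ∂(M.trajLaw p) =
        ∫ ω, M.resid h v g (ω.1 h.castSucc, ω.2 h) ∂(M.trajLaw p) := fun {p} hp => by
    rw [hres hp, M.integral_trajLaw_step hp h (M.bddMeas_excess hv hg)]
    exact integral_congr_ae (Filter.Eventually.of_forall fun z => M.integral_excess hv z.1 z.2)
  have key := measure_le_exp_neg_of_conditional (κ := fun t ω => M.trajLaw (π t ω))
    (fun t ht ω => M.isProbabilityMeasure_trajLaw (hπ t ht ω)) hτ hlaw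
    ((BddMeas.const c).mul hZ) ((BddMeas.const (c / 2)).mul hm)
    (fun t ht ω => by
      have := M.isProbabilityMeasure_trajLaw (hπ t ht ω)
      refine integral_exp_neg_le (K := 16 * R ^ 2) hc0.le hZ (fun ω' => ?_) (hexc (hπ t ht ω)) ?_
        (fun _ => sq_nonneg _) ?_
      · have := mul_le_mul_of_nonneg_left (M.abs_excess_le (h := h) hvR hgR
          (ω'.1 h.castSucc, ω'.2 h, ω'.1 h.succ)) hc0.le
        refine this.trans ?_
        rw [hc]
        field_simp
        norm_num
      · rw [← integral_const_mul]
        exact integral_mono ((hZ.pow 2).integrable _) ((hm.integrable _).const_mul _)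
          fun ω' => M.excess_sq_le hvR hgR _
      · rw [hc]
        field_simp
        norm_num) ht x
  refine le_trans (measure_mono fun ω hω => ?_) key
  rw [Set.mem_ofPred_eq] at hω ⊢
  have hω' := mul_le_mul_of_nonneg_left hω hc0.le
  have e : c * (32 * R ^ 2 * x) = x := by
    rw [hc]
    field_simp
  rw [e, Finset.mul_sum] at hω'
  refine hω'.trans_eq (Finset.sum_congr rfl fun i hi => ?_)
  rw [integral_const_mul, hres (hπ i ((Finset.mem_range.1 hi).trans_le ht) ω)]
  ring

end Excess

end EpisodicMDP
end VAC

namespace VAC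

/-! ### Nets and uniform concentration. -/

theorem exists_finset_of_coveringNumber_le {S A : Type*} {F : Set (S → A → ℝ)} {ε : ℝ} {n : ℕ}
    (h : coveringNumber F ε ≤ n) :
    ∃ C : Finset (S → A → ℝ), (C : Set (S → A → ℝ)) ⊆ F ∧
      (∀ q ∈ F, ∃ c ∈ C, ∀ s a, |q s a - c s a| ≤ ε) ∧ C.card ≤ n := by
  have hlt : coveringNumber F ε < ((n + 1 : ℕ) : ℕ∞) :=
    h.trans_lt (by exact_mod_cast Nat.lt_succ_self n)
  simp only [coveringNumber, iInf_lt_iff] at hlt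
  obtain ⟨C, hCF, hC, hn⟩ := hlt
  have hfin : C.Finite := Set.encard_lt_top_iff.1 (hn.trans (ENat.natCast_lt_top _))
  refine ⟨hfin.toFinset, by simpa using hCF, by simpa using hC, ?_⟩
  rw [hfin.encard_eq_coe_toFinset_card] at hn
  exact Nat.lt_succ_iff.1 (by exact_mod_cast hn)

theorem measure_biUnion_le_of_card {Ω ι κ : Type*} {mΩ : MeasurableSpace Ω} (μ : Measure Ω)
    (I : Finset ι) (J : ι → Finset κ) {n : ℕ} (hJ : ∀ i ∈ I, (J i).card ≤ n)
    (E : ι → κ → Set Ω) {c : ENNReal} (hE : ∀ i ∈ I, ∀ j ∈ J i, μ (E i j) ≤ c) :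
    μ (⋃ i ∈ I, ⋃ j ∈ J i, E i j) ≤ I.card * n * c := by
  calc _ ≤ ∑ i ∈ I, ∑ j ∈ J i, μ (E i j) := (measure_biUnion_finset_le _ _).trans
        (Finset.sum_le_sum fun i _ => measure_biUnion_finset_le _ _)
    _ ≤ ∑ i ∈ I, (n : ENNReal) * c := by
        refine Finset.sum_le_sum fun i hi => (Finset.sum_le_sum fun j hj => hE i hi j hj).trans ?_
        rw [Finset.sum_const, nsmul_eq_mul]
        gcongr
        exact hJ i hi
    _ = I.card * n * c := by rw [Finset.sum_const, nsmul_eq_mul, mul_assoc]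

namespace EpisodicMDP

variable {S A : Type*} [MeasurableSpace S] [MeasurableSpace A] [Fintype A]
  (M : EpisodicMDP S A)

section Nets

variable {Q : ℕ → Set (S → A → ℝ)} {B : ℝ}

omit [Fintype A] in
theorem exists_finset_of_maxCovering_lt_top {ε : ℝ} (hfin : M.maxCovering Q ε < ⊤) {h : ℕ}
    (hh : h < M.H) :
    ∃ C : Finset (S → A → ℝ), (C : Set (S → A → ℝ)) ⊆ Q h ∧
      (∀ q ∈ Q h, ∃ c ∈ C, ∀ s a, |q s a - c s a| ≤ ε) ∧
      C.card ≤ (M.maxCovering Q ε).toNat := by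
  refine exists_finset_of_coveringNumber_le ?_
  rw [ENat.natCast_toNat hfin.ne]
  exact le_iSup (fun h : Fin M.H => coveringNumber (Q h) ε) ⟨h, hh⟩

theorem one_le_toNat_maxCovering (hQ : M.QClassAssumption Q B) {ε : ℝ}
    (hfin : M.maxCovering Q ε < ⊤) : 1 ≤ (M.maxCovering Q ε).toNat := by
  obtain ⟨C, -, hC, hn⟩ := M.exists_finset_of_maxCovering_lt_top hfin M.H_pos
  obtain ⟨c, hc, -⟩ := hC _ (hQ.realizable 0 M.H_pos)
  exact (Finset.card_pos.2 ⟨c, hc⟩).trans_le hn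

variable (hQ : M.QClassAssumption Q B)

include hQ

theorem abs_le_of_mem {h : ℕ} (hh : h < M.H) {q : S → A → ℝ} (hq : q ∈ Q h) (s : S) (a : A) :
    |q s a| ≤ M.H :=
  (hQ.bounded h hh q hq s a).trans (sub_le_self _ (Nat.cast_nonneg _))

theorem abs_le_of_mem_succ {h : ℕ} (hh : h + 1 < M.H) {q : S → A → ℝ} (hq : q ∈ Q (h + 1))
    (s : S) (a : A) : |q s a| ≤ (M.H : ℝ) - 1 := by
  have := hQ.bounded (h + 1) hh q hq s a
  have h0 : (0 : ℝ) ≤ h := Nat.cast_nonneg h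
  push_cast at this
  linarith

theorem abs_QClass_succ_le {f : ℕ → S → A → ℝ} (hf : f ∈ M.QClass Q) (h : ℕ) (s : S) (a : A) :
    |f (h + 1) s a| ≤ (M.H : ℝ) - 1 := by
  rcases Nat.lt_or_ge (h + 1) M.H with h1 | h1
  · exact M.abs_le_of_mem_succ hQ h1 (hf.1 _ h1) s a
  · have : (1 : ℝ) ≤ M.H := by exact_mod_cast M.H_pos
    simpa [hf.2 _ h1] using this

theorem measurable_QClass {f : ℕ → S → A → ℝ} (hf : f ∈ M.QClass Q) (h : ℕ) (a : A) :
    Measurable fun s => f h s a := by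
  rcases Nat.lt_or_ge h M.H with h1 | h1
  · exact hQ.measurable h h1 _ (hf.1 h h1) a
  · rw [hf.2 h h1]
    exact measurable_const

theorem bddMeas_nextValue {f π : ℕ → S → A → ℝ} (hf : f ∈ M.QClass Q) (hπ : IsPolicy π) (h : ℕ) :
    BddMeas fun s => ∑ a, π (h + 1) s a * f (h + 1) s a :=
  BddMeas.finset_sum _ fun a _ => (bddMeas_policy hπ _ a).mul
    ⟨M.measurable_QClass hQ hf (h + 1) a, _, fun s => M.abs_QClass_succ_le hQ hf h s a⟩

theorem abs_nextValue_le {f π : ℕ → S → A → ℝ} (hf : f ∈ M.QClass Q) (hπ : IsPolicy π) (h : ℕ)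
    (s : S) : |∑ a, π (h + 1) s a * f (h + 1) s a| ≤ (M.H : ℝ) - 1 :=
  abs_simplex_sum_le (hπ.mem_simplex _ s) fun a => M.abs_QClass_succ_le hQ hf h s a

theorem bddMeas_of_mem [MeasurableSingletonClass A] {h : ℕ} (hh : h < M.H) {g : S → A → ℝ}
    (hg : g ∈ Q h) : BddMeas fun x : S × A => g x.1 x.2 :=
  BddMeas.of_fst (hQ.measurable h hh g hg) fun x => M.abs_le_of_mem hQ hh hg x.1 x.2

/-- Policy probabilities sum to one, so reward and prediction leave the average over actions: the
Bellman error in the Eluder coefficient is the bias seen by the regression. -/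
theorem ell_eq_resid {f π : ℕ → S → A → ℝ} (hf : f ∈ M.QClass Q) (hπ : IsPolicy π) (h : ℕ)
    (x : S × A) : M.ell f h x.1 x.2 π =
      M.resid h (fun s => ∑ a, π (h + 1) s a * f (h + 1) s a) (f h) x := by
  have e : ∀ s', ∑ a', π (h + 1) s' a' * (M.r h x.1 x.2 + f (h + 1) s' a' - f h x.1 x.2) =
      (∑ a', π (h + 1) s' a' * f (h + 1) s' a') + (M.r h x.1 x.2 - f h x.1 x.2) := fun s' => by
    calc _ = ∑ a', (π (h + 1) s' a' * f (h + 1) s' a' +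
          π (h + 1) s' a' * (M.r h x.1 x.2 - f h x.1 x.2)) :=
          Finset.sum_congr rfl fun a _ => by ring
      _ = _ := by rw [Finset.sum_add_distrib, ← Finset.sum_mul, (hπ.mem_simplex _ _).2, one_mul]
  simp only [ell, e, resid, backup]
  rw [integral_add ((M.bddMeas_nextValue hQ hf hπ h).integrable _) (integrable_const _)]
  simp only [integral_const, probReal_univ, one_smul]
  ring

/-- A finite net for the pairs (next value, prediction) of step `h`. -/
theorem exists_net [MeasurableSingletonClass A] [Nonempty A] (hB : 0 < B) {ε : ℝ} (hε : 0 ≤ ε)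
    (hε2 : ε ≤ 1 / 2)
    (hfin : M.maxCovering Q (ε / B) < ⊤) {h : ℕ} (hh : h < M.H) :
    ∃ W : Finset ((S → ℝ) × (S → A → ℝ)), W.card ≤ (M.maxCovering Q (ε / B)).toNat ^ 3 ∧
      (∀ p ∈ W, BddMeas p.1 ∧ (∀ s, |p.1 s| ≤ (M.H : ℝ) - 1) ∧ p.2 ∈ Q h) ∧
      ∀ f ∈ M.QClass Q, ∀ π ∈ M.PClass Q B, ∀ g ∈ Q h, ∃ p ∈ W,
        (∀ s, |(∑ a, π (h + 1) s a * f (h + 1) s a) - p.1 s| ≤ 8 * ε * M.H + ε / B) ∧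
        ∀ s a, |g s a - p.2 s a| ≤ ε / B := by
  classical
  set N := (M.maxCovering Q (ε / B)).toNat
  have hN : 1 ≤ N := M.one_le_toNat_maxCovering hQ hfin
  have hH : (1 : ℝ) ≤ M.H := by exact_mod_cast M.H_pos
  have hεB : 0 ≤ ε / B := div_nonneg hε hB.le
  obtain ⟨C, hCQ, hC, hCN⟩ := M.exists_finset_of_maxCovering_lt_top hfin hh
  rcases Nat.lt_or_ge (h + 1) M.H with h1 | h1
  · obtain ⟨C', hCQ', hC', hCN'⟩ := M.exists_finset_of_maxCovering_lt_top hfin h1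
    have hsm : ∀ q ∈ C', ∀ a, BddMeas fun s => softmax B q s a := fun q hq a =>
      BddMeas.of_mem_simplex (softmax_mem_simplex B q)
        (measurable_softmax B (hQ.measurable _ h1 q (hCQ' hq)) a)
    -- Three centres: one for the function inside the softmax at step `h + 1`, one for the critic
    -- there, one for the prediction at step `h`. Hence the cube.
    refine ⟨(C' ×ˢ C' ×ˢ C).image fun p => (fun s => ∑ a, softmax B p.1 s a * p.2.1 s a, p.2.2),
      ?_, ?_, ?_⟩
    · refine Finset.card_image_le.trans ?_
      rw [Finset.card_product, Finset.card_product]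
      calc _ ≤ N * (N * N) := Nat.mul_le_mul hCN' (Nat.mul_le_mul hCN' hCN)
        _ = N ^ 3 := by ring
    · intro p hp
      obtain ⟨⟨q, f, g⟩, hm, rfl⟩ := Finset.mem_image.1 hp
      simp only [Finset.mem_product] at hm
      refine ⟨BddMeas.finset_sum _ fun a _ => (hsm q hm.1 a).mul
        ⟨hQ.measurable _ h1 f (hCQ' hm.2.1) a, _,
          fun s => M.abs_le_of_mem_succ hQ h1 (hCQ' hm.2.1) s a⟩, fun s => ?_, hCQ hm.2.2⟩
      exact abs_simplex_sum_le (softmax_mem_simplex B q s) fun a =>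
        M.abs_le_of_mem_succ hQ h1 (hCQ' hm.2.1) s a
    · intro f hf π hπ g hg
      obtain ⟨q, hq, hπq⟩ := hπ.2 _ h1
      obtain ⟨q', hq', hqq'⟩ := hC' q hq
      obtain ⟨f', hf', hff'⟩ := hC' _ (hf.1 _ h1)
      obtain ⟨g', hg', hgg'⟩ := hC g hg
      refine ⟨_, Finset.mem_image_of_mem _ (Finset.mk_mem_product hq'
        (Finset.mk_mem_product hf' hg')), fun s => ?_, hgg'⟩
      rw [hπq]
      have m1 := softmax_mem_simplex B q s
      have m2 := softmax_mem_simplex B q' s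
      have e : (∑ a, softmax B q s a * f (h + 1) s a) - ∑ a, softmax B q' s a * f' s a =
          (∑ a, (softmax B q s a - softmax B q' s a) * f (h + 1) s a) +
            ∑ a, softmax B q' s a * (f (h + 1) s a - f' s a) := by
        rw [← Finset.sum_sub_distrib, ← Finset.sum_add_distrib]
        exact Finset.sum_congr rfl fun a _ => by ring
      have b1 : |∑ a, (softmax B q s a - softmax B q' s a) * f (h + 1) s a| ≤ 8 * ε * M.H := by
        calc _ ≤ ∑ a, |(softmax B q s a - softmax B q' s a) * f (h + 1) s a| :=
              Finset.abs_sum_le_sum_abs _ _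
          _ ≤ ∑ a, 4 * ε * (softmax B q s a + softmax B q' s a) * M.H := by
              refine Finset.sum_le_sum fun a _ => ?_
              rw [abs_mul]
              refine mul_le_mul (abs_softmax_sub_le hB hε hε2 (fun b => hqq' s b) a)
                (M.abs_le_of_mem hQ h1 (hf.1 _ h1) s a) (abs_nonneg _) ?_
              exact mul_nonneg (by linarith) (add_nonneg (m1.1 a) (m2.1 a))
          _ = 8 * ε * M.H := by
              rw [← Finset.sum_mul, ← Finset.mul_sum, Finset.sum_add_distrib, m1.2, m2.2]
              ring
      simp only [e]
      exact (abs_add_le _ _).trans (add_le_add b1 (abs_simplex_sum_le m2 fun a => hff' s a))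
  -- At the last step the next critic is `0`, so the next value vanishes whatever the policy does
  -- and only the prediction needs a centre.
  · refine ⟨C.image fun g => (fun _ => 0, g), ?_, ?_, ?_⟩
    · exact (Finset.card_image_le.trans hCN).trans (Nat.le_self_pow (by norm_num) N)
    · intro p hp
      obtain ⟨g, hg, rfl⟩ := Finset.mem_image.1 hp
      exact ⟨BddMeas.const 0, fun s => by simpa using hH, hCQ hg⟩
    · intro f hf π _ g hg
      obtain ⟨g', hg', hgg'⟩ := hC g hg
      refine ⟨_, Finset.mem_image_of_mem _ hg', fun s => ?_, hgg'⟩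
      rw [hf.2 _ h1]
      simp only [Pi.zero_apply, mul_zero, Finset.sum_const_zero, sub_zero, abs_zero]
      positivity

/-- Uniform concentration of the excess losses over the whole class. -/
theorem exists_uniform_deviation [MeasurableSingletonClass A] [Nonempty A] (hB : 0 < B) {ε δ : ℝ}
    (hε : 0 ≤ ε) (hε2 : ε ≤ 1 / 2) (hδ : 0 < δ) (hfin : M.maxCovering Q (ε / B) < ⊤)
    {Ω : Type*} {mΩ : MeasurableSpace Ω} {μ : Measure Ω}
    [IsProbabilityMeasure μ] {ℱ : Filtration ℕ mΩ} {T : ℕ} (hT : 0 < T)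
    {π : ℕ → Ω → ℕ → S → A → ℝ}
    {τ : ℕ → Ω → M.Traj} (hπ : ∀ t < T, ∀ ω, IsPolicy (π t ω))
    (hτ : ∀ t < T, Measurable[ℱ (t + 1)] (τ t))
    (hlaw : ∀ t < T, ∀ E : Set M.Traj, MeasurableSet E →
      μ[(τ t ⁻¹' E).indicator (fun _ => (1 : ℝ)) | ℱ t] =ᵐ[μ]
        fun ω => (M.trajLaw (π t ω)).real E) :
    ∃ bad : Set Ω, μ bad ≤ ENNReal.ofReal δ ∧ ∀ ω ∉ bad, ∀ t < T, ∀ h : Fin M.H,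
      ∀ f ∈ M.QClass Q, ∀ p ∈ M.PClass Q B, ∀ g ∈ Q h,
        1 / 2 * (∑ i ∈ Finset.range t, ∫ z, M.resid h
          (fun s => ∑ a, p (h + 1) s a * f (h + 1) s a) g z ∂(M.occ (π i ω) h)) -
          (32 * (M.H : ℝ) ^ 2 * Real.log
              (T * M.H * ((M.maxCovering Q (ε / B)).toNat : ℝ) ^ 3 / δ) +
            T * (12 * M.H * (8 * ε * M.H + 2 * (ε / B)))) ≤
        M.sqLoss (fun i => τ i ω) t f p h g -
          M.sqLoss (fun i => τ i ω) t f p h (M.bellman p f h) := by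
  set N := (M.maxCovering Q (ε / B)).toNat with hNdef
  have hN : (1 : ℝ) ≤ N := by exact_mod_cast M.one_le_toNat_maxCovering hQ hfin
  have hH : (1 : ℝ) ≤ M.H := by exact_mod_cast M.H_pos
  have hT' : (1 : ℝ) ≤ T := by exact_mod_cast hT
  -- Chosen so that `T * H * N ^ 3 * exp (-x) = δ`, the union bound over episodes, steps and net
  -- points.
  set x := Real.log (T * M.H * (N : ℝ) ^ 3 / δ) with hx
  have harg : 0 < T * M.H * (N : ℝ) ^ 3 / δ := by positivity
  choose W hWcard hW hWnet using fun h : Fin M.H =>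
    M.exists_net hQ hB hε hε2 hfin h.2
  set E : ℕ × Fin M.H → (S → ℝ) × (S → A → ℝ) → Set Ω := fun th p =>
    {ω | 32 * (M.H : ℝ) ^ 2 * x ≤ ∑ i ∈ Finset.range th.1,
      (1 / 2 * ∫ z, M.resid th.2 p.1 p.2 z ∂(M.occ (π i ω) th.2)
        - M.excess th.2 p.1 p.2
          ((τ i ω).1 th.2.castSucc, (τ i ω).2 th.2, (τ i ω).1 th.2.succ))} with hE
  refine ⟨⋃ th ∈ Finset.range T ×ˢ Finset.univ, ⋃ p ∈ W th.2, E th p, ?_, ?_⟩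
  · refine (measure_biUnion_le_of_card μ _ (fun th => W th.2) (fun th _ => hWcard th.2) E
      (c := ENNReal.ofReal (Real.exp (-x))) fun th hth p hp => ?_).trans ?_
    · obtain ⟨b1, b2, b3⟩ := hW th.2 p hp
      exact M.measure_excess_deviation hπ hτ hlaw th.2 (by linarith) b1
        (M.bddMeas_of_mem hQ th.2.2 b3) b2 (M.abs_le_of_mem hQ th.2.2 b3)
        (Finset.mem_range.1 (Finset.mem_product.1 hth).1).le x
    · rw [Finset.card_product, Finset.card_range, Finset.card_univ, Fintype.card_fin,
        ← ENNReal.ofReal_natCast, ← ENNReal.ofReal_natCast (N ^ 3),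
        ← ENNReal.ofReal_mul (by positivity), ← ENNReal.ofReal_mul (by positivity)]
      refine ENNReal.ofReal_le_ofReal (le_of_eq ?_)
      rw [Real.exp_neg, hx, Real.exp_log harg]
      push_cast
      field_simp
  · intro ω hω t ht h f hf p hp g hg
    obtain ⟨c, hc, hc1, hc2⟩ := hWnet h f hf p hp g hg
    obtain ⟨b1, b2, b3⟩ := hW h c hc
    have hnot : ω ∉ E (t, h) c := fun hmem => hω <| by
      simp only [Set.mem_iUnion]
      exact ⟨(t, h), Finset.mk_mem_product (Finset.mem_range.2 ht) (Finset.mem_univ h), c, hc, hmem⟩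
    rw [hE, Set.mem_ofPred_eq, not_le] at hnot
    rw [M.sqLoss_sub_sqLoss hp.1]
    set v : S → ℝ := fun s => ∑ a, p (h + 1) s a * f (h + 1) s a with hv
    have hvm : BddMeas v := M.bddMeas_nextValue hQ hf hp.1 h
    have hvR : ∀ s, |v s| ≤ (M.H : ℝ) - 1 := M.abs_nextValue_le hQ hf hp.1 h
    have hgR := M.abs_le_of_mem hQ h.2 hg
    have hcR := M.abs_le_of_mem hQ h.2 b3
    set e := 8 * ε * M.H + ε / B + ε / B with he
    -- Replacing the pair by its net point costs `4He` in the residual, which carries a factor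
    -- `1/2`, and `10He` in the excess: `12He` per episode.
    have hterm : ∀ i ∈ Finset.range t,
        1 / 2 * ∫ z, M.resid h v g z ∂(M.occ (π i ω) h) -
          M.excess h v g ((τ i ω).1 h.castSucc, (τ i ω).2 h, (τ i ω).1 h.succ) ≤
        (1 / 2 * ∫ z, M.resid h c.1 c.2 z ∂(M.occ (π i ω) h) -
          M.excess h c.1 c.2 ((τ i ω).1 h.castSucc, (τ i ω).2 h, (τ i ω).1 h.succ)) +
          12 * M.H * e := by
      intro i hi
      have := M.isProbabilityMeasure_occ (hπ i ((Finset.mem_range.1 hi).trans ht) ω) h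
      have i1 := M.bddMeas_resid (h := h) hvm (M.bddMeas_of_mem hQ h.2 hg)
      have i2 := M.bddMeas_resid (h := h) b1 (M.bddMeas_of_mem hQ h.2 b3)
      have h1 := integral_mono (i1.integrable (M.occ (π i ω) h))
        ((i2.add (BddMeas.const (4 * M.H * e))).integrable (M.occ (π i ω) h))
        fun z => M.resid_le_add hvR hgR b2 hcR hvm b1 hc1 hc2 z
      rw [integral_add (i2.integrable _) (integrable_const _)] at h1
      simp only [integral_const, probReal_univ, one_smul] at h1
      have h2 := M.excess_le_add (h := h) hvR hgR b2 hcR hvm b1 hc1 hc2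
        ((τ i ω).1 h.castSucc, (τ i ω).2 h, (τ i ω).1 h.succ)
      linarith
    have hsum := Finset.sum_le_sum hterm
    rw [Finset.sum_sub_distrib, ← Finset.mul_sum, Finset.sum_add_distrib, Finset.sum_const,
      Finset.card_range, nsmul_eq_mul] at hsum
    have hte : (t : ℝ) * (12 * M.H * e) ≤ T * (12 * M.H * (8 * ε * M.H + 2 * (ε / B))) := by
      rw [he, show 8 * ε * M.H + ε / B + ε / B = 8 * ε * M.H + 2 * (ε / B) by ring]
      refine mul_le_mul_of_nonneg_right (by exact_mod_cast ht.le) ?_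
      have := div_nonneg hε hB.le
      positivity
    linarith

end Nets

end EpisodicMDP
end VAC

/-! ### Loss bounds and the regret decomposition. -/

namespace VAC
namespace EpisodicMDP

variable {S A : Type*} [MeasurableSpace S] [MeasurableSpace A] [Fintype A]
  (M : EpisodicMDP S A) {Q : ℕ → Set (S → A → ℝ)} {B : ℝ}

/-- The infimum that defines the generalized Eluder coefficient is attained. -/
theorem isGEC_dGEC {T : ℕ} {lam : ℝ} (h : ∃ d, M.IsGEC Q B T lam d) :
    M.IsGEC Q B T lam (M.dGEC Q B T lam) := by
  refine IsClosed.csInf_mem (s := {d | M.IsGEC Q B T lam d}) ?_ h ⟨0, fun d hd => hd.1⟩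
  -- For each fixed `η` the inequality is a closed condition on `d`, so the admissible set is an
  -- intersection of closed sets.
  simp only [IsGEC, Set.ofPred_and, Set.ofPred_forall]
  refine isClosed_Ici.inter (isClosed_iInter fun f => isClosed_iInter fun π =>
    isClosed_iInter fun _ => isClosed_iInter fun _ => isClosed_iInter fun η =>
      isClosed_iInter fun _ => isClosed_le continuous_const ?_)
  fun_prop

theorem sqLoss_nonneg {π : ℕ → S → A → ℝ} (hπ : IsPolicy π) (τ : ℕ → M.Traj) (t : ℕ)
    (f : ℕ → S → A → ℝ) (h : Fin M.H) (g : S → A → ℝ) : 0 ≤ M.sqLoss τ t f π h g :=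
  Finset.sum_nonneg fun _ _ => Finset.sum_nonneg fun a _ =>
    mul_nonneg ((hπ.mem_simplex _ _).1 a) (sq_nonneg _)

/-- For a Bellman-consistent pair, `f h` is itself the regression target, so no competitor `g` beats
it by more than `β`. -/
theorem loss_le_of_bellman_eq {π f : ℕ → S → A → ℝ} (hf : f ∈ M.QClass Q)
    (τ : ℕ → M.Traj) (t : ℕ) {β : ℝ} (hbell : ∀ h < M.H, M.bellman π f h = f h)
    (hβ : ∀ h : Fin M.H, ∀ g ∈ Q h,
      -β ≤ M.sqLoss τ t f π h g - M.sqLoss τ t f π h (M.bellman π f h)) :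
    M.loss Q τ t f π ≤ M.H * β := by
  calc M.loss Q τ t f π ≤ ∑ _h : Fin M.H, β := by
        refine Finset.sum_le_sum fun h _ => ?_
        have : Nonempty (Q h) := ⟨⟨f h, hf.1 h h.2⟩⟩
        have h1 : M.sqLoss τ t f π h (f h) - β ≤ ⨅ g : Q h, M.sqLoss τ t f π h g.1 :=
          le_ciInf fun g => by
            have := hβ h g.1 g.2
            rw [hbell h h.2] at this
            linarith
        linarith
    _ = M.H * β := by rw [Finset.sum_const, Finset.card_univ, Fintype.card_fin, nsmul_eq_mul]

/-- Completeness makes the backup `bellman π f h` a competitor in the infimum, so the loss is at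
least the excess over that backup. -/
theorem le_loss (hQ : M.QClassAssumption Q B) {π f : ℕ → S → A → ℝ} (hf : f ∈ M.QClass Q)
    (hπ : π ∈ M.PClass Q B) (τ : ℕ → M.Traj) (t : ℕ) {β : ℝ} {c : Fin M.H → ℝ}
    (hβ : ∀ h : Fin M.H, c h - β ≤
      M.sqLoss τ t f π h (f h) - M.sqLoss τ t f π h (M.bellman π f h)) :
    ∑ h, c h - M.H * β ≤ M.loss Q τ t f π := by
  calc ∑ h, c h - M.H * β = ∑ h : Fin M.H, (c h - β) := by
        rw [Finset.sum_sub_distrib, Finset.sum_const, Finset.card_univ, Fintype.card_fin,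
          nsmul_eq_mul]
    _ ≤ _ := by
        refine Finset.sum_le_sum fun h _ => (hβ h).trans (sub_le_sub_left ?_ _)
        exact ciInf_le (f := fun g : Q h => M.sqLoss τ t f π h g.1)
          ⟨0, by rintro _ ⟨g, rfl⟩; exact M.sqLoss_nonneg hπ.1 τ t f h g.1⟩
          ⟨_, hQ.complete π hπ f hf h h.2⟩

/-- The regret decomposition of an optimistic run. -/
theorem regret_le_of_loss_bounds {T : ℕ} {α lam d b κ : ℝ} (hα : 0 < α)
    (hGEC : M.IsGEC Q B T lam d) {f π : ℕ → ℕ → S → A → ℝ} {f' π' : ℕ → S → A → ℝ}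
    {ℓ ℓ' : ℕ → ℝ} (hf : ∀ t < T, f t ∈ M.QClass Q) (hπ : ∀ t < T, π t ∈ M.PClass Q B)
    (hmax : ∀ t < T, M.Vf f' π' - α * ℓ' t ≤ M.Vf (f t) (π t) - α * ℓ t)
    (hℓ' : ∀ t < T, ℓ' t ≤ b)
    (hℓ : ∀ t < T, 1 / 2 * (∑ i ∈ Finset.range t, ∑ h ∈ Finset.range M.H,
      ∫ x, M.ell (f t) h x.1 x.2 (π t) ∂(M.occ (π i) h)) - b ≤ ℓ t)
    (hstar : M.Vstarρ ≤ M.Vf f' π' + κ) :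
    M.regret T π ≤ T * κ + T * (2 * α * b) + 2 * d / α + √(d * M.H * T) + lam * M.H * T := by
  -- The loss, weighted by `α`, controls half of the squared Bellman errors; `η = α / 2` makes them
  -- cancel.
  have h1 := hGEC.2 f π hf hπ (α / 2) (half_pos hα)
  have h2 : ∀ t ∈ Finset.range T, M.Vstarρ - M.Vρ (π t) ≤
      (κ + 2 * α * b) + (M.Vf (f t) (π t) - M.Vρ (π t)) - α / 2 * (∑ i ∈ Finset.range t,
        ∑ h ∈ Finset.range M.H, ∫ x, M.ell (f t) h x.1 x.2 (π t) ∂(M.occ (π i) h)) := by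
    intro t ht
    have ht := Finset.mem_range.1 ht
    have e1 := hmax t ht
    have e2 := mul_le_mul_of_nonneg_left (hℓ' t ht) hα.le
    have e3 := mul_le_mul_of_nonneg_left (hℓ t ht) hα.le
    rw [mul_sub, ← mul_assoc] at e3
    linarith
  have h3 := Finset.sum_le_sum h2
  rw [Finset.sum_sub_distrib (fun t => _ + _), Finset.sum_add_distrib, Finset.sum_const,
    Finset.card_range, nsmul_eq_mul, ← Finset.mul_sum] at h3
  rw [regret]
  have e : d / (α / 2) = 2 * d / α := by field_simp
  rw [e] at h1
  linarith

end EpisodicMDP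

/-! ### Numerical estimates. -/

theorem rpow_three_halves {x : ℝ} (hx : 0 < x) : x ^ (3 / 2 : ℝ) = x * √x := by
  rw [show (3 / 2 : ℝ) = 1 + 1 / 2 by norm_num, Real.rpow_add hx, Real.rpow_one, Real.sqrt_eq_rpow]

theorem half_le_log {x : ℝ} (hx : 2 ≤ x) : 1 / 2 ≤ Real.log x := by
  have := Real.log_le_log (by norm_num) hx
  linarith [Real.log_two_gt_d9]

theorem deviation_le {H T N δ ε B la L : ℝ} (hH : 1 ≤ H) (hT : 2 ≤ T) (hla : 1 / 2 ≤ la)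
    (hN : 1 ≤ N) (hδ : 0 < δ) (hεT : ε ≤ 1 / T) (hB : B = T * la / H) (hL2 : 1 / 2 ≤ L)
    (hlog : 0 ≤ Real.log (H * T / δ)) (hL : L = Real.log (H * T / δ) + Real.log N) :
    32 * H ^ 2 * Real.log (T * H * N ^ 3 / δ) + T * (12 * H * (8 * ε * H + 2 * (ε / B))) ≤
      336 * H ^ 2 * L := by
  have hT0 : 0 < T := by linarith
  have e1 : Real.log (T * H * N ^ 3 / δ) ≤ 3 * L := by
    rw [show T * H * N ^ 3 / δ = (H * T / δ) * N ^ 3 by ring,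
      Real.log_mul (by positivity) (by positivity), Real.log_pow]
    push_cast
    linarith
  have e2 : T * ε ≤ 1 := by
    have := mul_le_mul_of_nonneg_left hεT hT0.le
    rwa [mul_one_div, div_self hT0.ne'] at this
  have e3 : T * (ε / B) ≤ H := by
    have h1 : (1 : ℝ) ≤ T * la := by
      have := mul_le_mul hT hla (by norm_num) hT0.le
      linarith
    have h2 : T * (ε / B) = (T * ε) * H / (T * la) := by
      rw [hB, div_div_eq_mul_div]
      ring
    rw [h2, div_le_iff₀ (by linarith)]
    calc T * ε * H ≤ 1 * H := by gcongr
      _ ≤ H * (T * la) := by rw [one_mul]; exact le_mul_of_one_le_right (by linarith) h1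
  have e4 := mul_le_mul_of_nonneg_left e1 (by positivity : 0 ≤ 32 * H ^ 2)
  have e5 := mul_le_mul_of_nonneg_left e2 (by positivity : 0 ≤ 96 * H ^ 2)
  have e6 := mul_le_mul_of_nonneg_left e3 (by positivity : 0 ≤ 24 * H)
  have e7 := mul_le_mul_of_nonneg_left hL2 (by positivity : 0 ≤ 240 * H ^ 2)
  calc _ = 32 * H ^ 2 * Real.log (T * H * N ^ 3 / δ) + 96 * H ^ 2 * (T * ε) +
        -- The logarithm contributes `32 · 3 = 96`; the discretization contributes `96 + 24 = 120`,
        -- turned into `240 L` by `L ≥ 1/2`.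
        24 * H * (T * (ε / B)) := by ring
    _ ≤ 32 * H ^ 2 * (3 * L) + 96 * H ^ 2 * 1 + 24 * H * H := by linarith
    _ = 96 * H ^ 2 * L + 240 * H ^ 2 * (1 / 2) := by ring
    _ ≤ 96 * H ^ 2 * L + 240 * H ^ 2 * L := by linarith
    _ = _ := by ring

end VAC

/-! ### The regret bound. -/

open VAC in
theorem mainTheorem2 :
    ∃ C : ℝ, 0 < C ∧
      ∀ (S A : Type*) [MeasurableSpace S] [MeasurableSpace A] [MeasurableSingletonClass A]
        [Fintype A] (_hA : 2 ≤ Fintype.card A)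
        (M : VAC.EpisodicMDP S A) (Q : ℕ → Set (S → A → ℝ)) (T : ℕ) (_hT : 0 < T)
        (B : ℝ) (_hB : B = T * Real.log (Fintype.card A) / M.H)
        (_hQ : M.QClassAssumption Q B)
        (_hGEC : ∀ lam : ℝ, 0 < lam → ∃ d, M.IsGEC Q B T lam d)
        (_hcov : ∀ ε : ℝ, 0 < ε → M.maxCovering Q ε < ⊤)
        (ε : ℝ) (_hε : 0 < ε) (_hεT : ε ≤ 1 / T)
        (δ : ℝ) (_hδ : 0 < δ) (_hδ1 : δ < 1)
        (N : ℝ) (_hN : N = ((M.maxCovering Q (M.H * ε / (T * Real.log (Fintype.card A)))).toNat : ℝ))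
        (L : ℝ) (_hL : L = Real.log (M.H * T / δ) + Real.log N)
        (D : ℝ) (_hD : D = max (M.dGEC Q B T √(M.H / T)) (1 / L))
        (α : ℝ) (_hα : α = √(1 / (T * (M.H : ℝ) ^ 3 * Real.log (N * M.H * T / δ)) * D))
        (Ω : Type*) (mΩ : MeasurableSpace Ω) (μ : MeasureTheory.Measure Ω)
        [MeasureTheory.IsProbabilityMeasure μ] (ℱ : MeasureTheory.Filtration ℕ mΩ)
        (f π : ℕ → Ω → ℕ → S → A → ℝ) (τ : ℕ → Ω → M.Traj)
        (_hrun : M.IsVACRun Q B α T μ ℱ f π τ),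
        ENNReal.ofReal (1 - δ) ≤
          μ {ω | M.regret T (fun t => π t ω) ≤
            C * ((M.H : ℝ) ^ (3 / 2 : ℝ) * √T * √(L * D))} := by
  -- The five contributions `b1`–`b5` below are `1`, `672`, `2`, `2` and `1` times the rate, so
  -- `678` would suffice.
  refine ⟨1000, by norm_num, ?_⟩
  intro S A _ _ _ _ hA M Q T hT B hB hQ hGEC hcov ε hε hεT δ hδ hδ1 N hN L hL D hD α hα Ω mΩ μ _
    ℱ f π τ hrun
  have hne : Nonempty A := Fintype.card_pos_iff.1 (by omega)
  have hH : (1 : ℝ) ≤ M.H := by exact_mod_cast M.H_pos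
  have hT' : (1 : ℝ) ≤ T := by exact_mod_cast hT
  have hH0 : (0 : ℝ) < M.H := by linarith
  have hT0 : (0 : ℝ) < T := by linarith
  set la := Real.log (Fintype.card A) with hla
  have hla2 : 1 / 2 ≤ la := half_le_log (by exact_mod_cast hA)
  have hla0 : 0 < la := by linarith
  have hB0 : 0 < B := by rw [hB]; positivity
  have hεB : M.H * ε / (T * la) = ε / B := by rw [hB]; field_simp
  rw [hεB] at hN
  have hfin := hcov (ε / B) (by positivity)
  have hN1 : 1 ≤ N := by rw [hN]; exact_mod_cast M.one_le_toNat_maxCovering hQ hfin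
  have hN0 : 0 < N := by linarith
  have hlogN : 0 ≤ Real.log N := Real.log_nonneg hN1
  have hHT1 : (1 : ℝ) < M.H * T / δ := by
    rw [lt_div_iff₀ hδ]
    nlinarith
  have hlogHT := Real.log_pos hHT1
  have hL0 : 0 < L := by linarith
  -- The floor `1 / L` in `D` makes the rate at least `H^{3/2} √T`, which absorbs the terms not
  -- involving `d`.
  have hLD : 1 ≤ L * D := by
    have := mul_le_mul_of_nonneg_left (hD ▸ le_max_right _ _ : 1 / L ≤ D) hL0.le
    rwa [mul_one_div, div_self hL0.ne'] at this
  have hP : 1 ≤ √(L * D) := Real.one_le_sqrt.2 hLD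
  have hsH : 0 < √(M.H : ℝ) := Real.sqrt_pos.2 hH0
  have hsT : 0 < √(T : ℝ) := Real.sqrt_pos.2 hT0
  have hsH2 : √(M.H : ℝ) * √(M.H : ℝ) = M.H := Real.mul_self_sqrt hH0.le
  have hsT2 : √(T : ℝ) * √(T : ℝ) = T := Real.mul_self_sqrt hT0.le
  rw [rpow_three_halves hH0]
  set R := (M.H : ℝ) * √(M.H : ℝ) * √(T : ℝ) * √(L * D) with hR
  have hR1 : (M.H : ℝ) * √(M.H : ℝ) * √(T : ℝ) ≤ R := le_mul_of_one_le_right (by positivity) hP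
  have hR0 : 0 < R := lt_of_lt_of_le (by positivity) hR1
  -- For `T ≤ H` the trivial bound `HT` is already below the rate. Otherwise `T ≥ 2`, so `ε ≤ 1/2`,
  -- and `H²` is below the rate.
  rcases le_or_gt T M.H with hTH | hTH
  · have huniv : {ω | M.regret T (fun t => π t ω) ≤ 1000 * R} = Set.univ := by
      refine Set.eq_univ_of_forall fun ω => ?_
      have h1 := M.regret_le_horizon_mul fun t ht => (hrun.π_mem t ht ω).1
      have h2 : √(T : ℝ) ≤ √(M.H : ℝ) := Real.sqrt_le_sqrt (by exact_mod_cast hTH)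
      have h3 : (M.H : ℝ) * T ≤ M.H * √(M.H : ℝ) * √(T : ℝ) := by
        rw [mul_assoc]
        refine mul_le_mul_of_nonneg_left ?_ hH0.le
        calc (T : ℝ) = √(T : ℝ) * √(T : ℝ) := hsT2.symm
          _ ≤ √(M.H : ℝ) * √(T : ℝ) := mul_le_mul_of_nonneg_right h2 hsT.le
      change M.regret T (fun t => π t ω) ≤ 1000 * R
      linarith
    rw [huniv, measure_univ]
    exact ENNReal.ofReal_le_one.2 (by linarith)
  have hT2 : (2 : ℝ) ≤ T := by
    have := M.H_pos
    exact_mod_cast (by omega : 2 ≤ T)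
  have hL2 : 1 / 2 ≤ L := by
    have : (2 : ℝ) ≤ M.H * T / δ := by
      rw [le_div_iff₀ hδ]
      nlinarith
    linarith [half_le_log this]
  obtain ⟨f', hf', π', hπ', hbell, hstar⟩ := M.exists_comparator hQ hB0
  obtain ⟨bad, hbad, hgood⟩ := M.exists_uniform_deviation hQ hB0 hε.le
    (hεT.trans (one_div_le_one_div_of_le (by norm_num) hT2)) hδ hfin hT
    (fun t ht ω => (hrun.π_mem t ht ω).1) hrun.adapted hrun.law
  rw [← hN] at hgood
  set β := 32 * (M.H : ℝ) ^ 2 * Real.log (T * M.H * N ^ 3 / δ) +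
    T * (12 * M.H * (8 * ε * M.H + 2 * (ε / B))) with hβ
  have hβL : β ≤ 336 * (M.H : ℝ) ^ 2 * L := by
    exact deviation_le hH hT2 hla2 hN1 hδ hεT hB (by linarith) hlogHT.le hL
  have hD0 : 0 < D := lt_of_lt_of_le (one_div_pos.2 hL0) (hD ▸ le_max_right _ _)
  set d := M.dGEC Q B T √(M.H / T) with hd
  have hdD : d ≤ D := hD ▸ le_max_left _ _
  have hG : M.IsGEC Q B T √(M.H / T) d := M.isGEC_dGEC (hGEC _ (Real.sqrt_pos.2 (by positivity)))
  set K := T * (M.H : ℝ) ^ 3 * L with hK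
  have hK0 : 0 < K := by positivity
  have hαK : α = √(D / K) := by
    rw [hα, hK, hL, show N * M.H * T / δ = (M.H * T / δ) * N by ring,
      Real.log_mul (by positivity) hN0.ne', one_div_mul_eq_div]
  have hα0 : 0 < α := by rw [hαK]; exact Real.sqrt_pos.2 (by positivity)
  have hα2 : α * α = D / K := by rw [hαK]; exact Real.mul_self_sqrt (by positivity)
  have hRR : R * R = K * D := by
    rw [hR, hK]
    calc _ = (M.H : ℝ) ^ 2 * (√(M.H : ℝ) * √(M.H : ℝ)) * (√(T : ℝ) * √(T : ℝ)) *
          (√(L * D) * √(L * D)) := by ring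
      _ = _ := by rw [hsH2, hsT2, Real.mul_self_sqrt (by linarith)]; ring
  -- The balance behind the choice of `α`: the statistical cost `α * K` and the exploration cost `D
  -- / α` both equal `R`.
  have hαR : α * K = R := by
    have : (α * K) * (α * K) = R * R := by
      rw [hRR, show α * K * (α * K) = α * α * (K * K) by ring, hα2]
      field_simp
    exact (mul_self_inj (by positivity) hR0.le).1 this
  have hDα : D / α = R := by
    rw [← hαR, div_eq_iff hα0.ne', show α * K * α = α * α * K by ring, hα2]
    field_simp
  have hmain : badᶜ ⊆ {ω | M.regret T (fun t => π t ω) ≤ 1000 * R} := by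
    intro ω hω
    have hg := hgood ω hω
    have hreg := M.regret_le_of_loss_bounds (b := M.H * β) hα0 hG
      (f := fun t => f t ω) (π := fun t => π t ω)
      (ℓ := fun t => M.loss Q (fun i => τ i ω) t (f t ω) (π t ω))
      (ℓ' := fun t => M.loss Q (fun i => τ i ω) t f' π')
      (fun t ht => hrun.f_mem t ht ω) (fun t ht => hrun.π_mem t ht ω)
      (fun t ht => hrun.maximal t ht ω f' hf' π' hπ')
      (fun t ht => M.loss_le_of_bellman_eq hf' _ t hbell fun h g hgQ => by
        refine le_trans ?_ (hg t ht h f' hf' π' hπ' g hgQ)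
        rw [neg_eq_zero_sub]
        refine sub_le_sub_right (mul_nonneg (by norm_num) (Finset.sum_nonneg fun i _ => ?_)) _
        exact integral_nonneg fun z => sq_nonneg _)
      (fun t ht => by
        refine le_trans (le_of_eq ?_) (M.le_loss hQ (hrun.f_mem t ht ω) (hrun.π_mem t ht ω) _ t
          fun h => hg t ht h _ (hrun.f_mem t ht ω) _ (hrun.π_mem t ht ω) _
            ((hrun.f_mem t ht ω).1 h h.2))
        rw [Finset.sum_comm, Finset.sum_range, Finset.mul_sum]
        simp only [M.ell_eq_resid hQ (hrun.f_mem t ht ω) (hrun.π_mem t ht ω).1])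
      hstar
    -- The total softmax gap is exactly `H²`, at most `H^{3/2} √T` because `H < T`.
    have b1 : T * (M.H * (la / B)) ≤ R := by
      have e : T * (M.H * (la / B)) = M.H * √(M.H : ℝ) * √(M.H : ℝ) := by
        rw [mul_assoc, hsH2, hB]
        field_simp
      rw [e]
      refine le_trans ?_ hR1
      gcongr
    have b2 : T * (2 * α * (M.H * β)) ≤ 672 * R := by
      have := mul_le_mul_of_nonneg_left hβL (by positivity : 0 ≤ 2 * T * α * M.H)
      calc _ = 2 * T * α * M.H * β := by ring
        _ ≤ _ := this
        _ = 672 * (α * K) := by rw [hK]; ring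
        _ = 672 * R := by rw [hαR]
    have b3 : 2 * d / α ≤ 2 * R := by
      rw [← hDα, mul_div_assoc]
      gcongr
    have b4 : √(d * M.H * T) ≤ 2 * R := by
      refine Real.sqrt_le_iff.2 ⟨by positivity, ?_⟩
      calc d * M.H * T ≤ D * M.H * T := by gcongr
        _ = D * M.H * T * (1 * 1) := by ring
        _ ≤ D * M.H * T * ((M.H : ℝ) ^ 2 * (4 * L)) := by
            refine mul_le_mul_of_nonneg_left ?_ (by positivity)
            exact mul_le_mul (one_le_pow₀ hH) (by linarith) (by norm_num) (by positivity)
        _ = 4 * (K * D) := by rw [hK]; ring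
        _ = (2 * R) ^ 2 := by rw [← hRR]; ring
    have b5 : √(M.H / T) * M.H * T ≤ R := by
      have e : √(M.H / T) * M.H * T = M.H * √(M.H : ℝ) * √(T : ℝ) := by
        have e' : (T : ℝ) / √(T : ℝ) = √(T : ℝ) := by rw [div_eq_iff hsT.ne', hsT2]
        rw [Real.sqrt_div hH0.le]
        calc _ = (M.H : ℝ) * √(M.H : ℝ) * (T / √(T : ℝ)) := by ring
          _ = _ := by rw [e']
      rw [e]
      exact hR1
    change M.regret T (fun t => π t ω) ≤ 1000 * R
    linarith
  -- Subadditivity is used in place of complements, since neither event is known to be measurable.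
  have h1 : (1 : ENNReal) ≤ μ {ω | M.regret T (fun t => π t ω) ≤ 1000 * R} + ENNReal.ofReal δ := by
    calc (1 : ENNReal) = μ Set.univ := measure_univ.symm
      _ ≤ μ ({ω | M.regret T (fun t => π t ω) ≤ 1000 * R} ∪ bad) := by
          refine measure_mono fun ω _ => ?_
          by_cases hω : ω ∈ bad
          exacts [Or.inr hω, Or.inl (hmain hω)]
      _ ≤ _ := (measure_union_le _ _).trans (by gcongr)
  rw [ENNReal.ofReal_sub _ hδ.le, ENNReal.ofReal_one]
  exact tsub_le_iff_right.2 h1
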